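/- Let $\Gamma$ be a group with identity $e$, and let $\Omega\subset\Gamma$ be a finite set with $e\in\Omega$ that generates $\Gamma$ as a semigroup: if $\Omega_n$ denotes the set of all words of length at most $n$ with letters in $\Omega$ (so $\Omega_0=\{e\}$), then $\bigcup_n\Omega_n=\Gamma$. For $Y\subseteq\Gamma$ let $P_Y$ be the orthogonal projection of $l^2(\Gamma)$ onto $l^2(Y)$, let $\mathrm{int}_\Omega Y=\{a\in Y:\Omega a\subseteq Y\}$ and $\partial_\Omega Y=Y\setminus\mathrm{int}_\Omega Y$. Put $(L_ru)(t)=u(r^{-1}t)$ and $(R_sf)(t)=f(ts)$ on $l^2(\Gamma)$, and let $\mathsf{Sh}(\Gamma)$ be the smallest closed subalgebra of $L(l^2(\Gamma))$ containing all $L_r$, $r\in\Gamma$. Let $\mathcal Y=(Y_n)_{n\in\mathbb N}$ be a sequence of finite subsets of $\Gamma$ with $\lim Y_n=\Gamma$ (every $x\in\Gamma$ lies in all but finitely many $Y_n$). Let $\mathcal S_{\mathcal Y}(\mathsf{Sh}(\Gamma))$ be the smallest closed $*$-subalgebra of the algebra of all bounded sequences $(A_n)$ of operators $A_n:\mathrm{im}\,P_{Y_n}\to\mathrm{im}\,P_{Y_n}$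 (with entrywise operations and supremum norm) that contains all sequences $(P_{Y_n}AP_{Y_n})$ with $A\in\mathsf{Sh}(\Gamma)$; each $A_n$ is identified with the operator $A_nP_{Y_n}$ on $l^2(\Gamma)$. Let $(v_n)$ be a sequence in $\Gamma$ for which the sets $(Y_n\cup\Omega_n)(Y_n\cup\Omega_n)^{-1}(Y_n\cup\Omega_n)v_n^{-1}$ are pairwise disjoint. Put $\Gamma'=\Gamma\setminus\bigcup_nY_nv_n^{-1}$ and, for $\mathbf A=(A_n)\in\mathcal S_{\mathcal Y}(\mathsf{Sh}(\Gamma))$, $\mathrm{Op}(\mathbf A)=\sum_nR_{v_n}A_nR_{v_n}^{-1}$ (strong convergence). For $T\in L(l^2(\Gamma))$ and a sequence $h:\mathbb N\to\Gamma$ tending to infinity (leaving every finite subset eventually), $T_h$ is called the limit operator of $T$ with respect to $h$ if $R_{h(n)}^{-1}TR_{h(n)}\to T_h$ and $R_{h(n)}^{-1}T^*R_{h(n)}\to T_h^*$ strongly. Let $\mathbf A=(A_n)\in\mathcal S_{\mathcal Y}(\mathsf{Sh}(\Gamma))$. Then the series defining $\mathrm{Op}(\mathbf A)$ converges strongly,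 the strong limit $A:=\text{s-lim}\,A_nP_{Y_n}$ exists, and the limit operators of $\mathrm{Op}(\mathbf A)+P_{\Gamma'}$ (with respect to all sequences tending to infinity) are exactly the identity operator $I$, the operator $A$, and all operators of the form $$\text{s-lim}_{n\to\infty}\,R_{w_*}^{-1}R_{\eta_{k_n}}^{-1}A_{k_n}R_{\eta_{k_n}}R_{w_*}+(P_{\Gamma'})_g,\qquad(*)$$ where $(k_n)$ is strictly increasing, $\eta_{k_n}\in(\partial_\Omega Y_{k_n})^{-1}$, $w_*\in\Gamma$, $g(n)=v_{k_n}\eta_{k_n}w_*$, and both the strong limit and the limit operator $(P_{\Gamma'})_g$ exist. More precisely, if the limit operator with respect to $h$ exists, then it is $I$, or it is $A$, or it has the form $(*)$ with $g$ a subsequence of $h$. -/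

import Mathlib

open Filter Topology
open scoped ENNReal Pointwise

noncomputable section

namespace GroupSections

/-- The Hilbert space `l²(Γ)`. -/
abbrev L2 (Γ : Type*) : Type _ := lp (fun _ : Γ => ℂ) 2

/-- The algebra of bounded linear operators on `l²(Γ)`. -/
abbrev Opr (Γ : Type*) : Type _ := L2 Γ →L[ℂ] L2 Γ

section Operators

variable {Γ : Type*}

theorem sum_sq_eq (f : L2 Γ) : HasSum (fun t => ‖f t‖ ^ 2) (‖f‖ ^ 2) := by
  have h := lp.hasSum_norm (p := 2) (by norm_num) f
  simpa using h

theorem memlp_of_summable {f : Γ → ℂ} (h : Summable fun t => ‖f t‖ ^ 2) :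
    Memℓp f 2 := by
  apply memℓp_gen
  simpa using h

/-- The isometry `f ↦ f ∘ e` of `l²(Γ)` induced by a permutation `e` of `Γ`. -/
def reindex (e : Equiv.Perm Γ) : Opr Γ :=
  LinearMap.mkContinuous
    { toFun := fun f =>
        ⟨fun t => f (e t), memlp_of_summable ((e.summable_iff).2 (sum_sq_eq f).summable)⟩
      map_add' := fun _ _ => rfl
      map_smul' := fun _ _ => rfl }
    1 (by
      intro f
      rw [one_mul]
      refine le_of_eq ?_
      refine (sq_eq_sq₀ (norm_nonneg _) (norm_nonneg _)).1 ?_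
      exact (sum_sq_eq _).unique ((e.hasSum_iff).2 (sum_sq_eq f)))

@[simp] theorem reindex_apply (e : Equiv.Perm Γ) (f : L2 Γ) (t : Γ) :
    reindex e f t = f (e t) := rfl

theorem summable_indicator (Y : Set Γ) (f : L2 Γ) :
    Summable fun t => ‖Y.indicator f t‖ ^ 2 :=
  Summable.of_nonneg_of_le (fun _ => by positivity)
    (fun t => pow_le_pow_left₀ (norm_nonneg _) (norm_indicator_le_norm_self _ _) 2)
    (sum_sq_eq f).summable

/-- The orthogonal projection `P_Y` of `l²(Γ)` onto its subspace `l²(Y)`. -/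
def proj (Y : Set Γ) : Opr Γ :=
  LinearMap.mkContinuous
    { toFun := fun f => ⟨Y.indicator f, memlp_of_summable (summable_indicator Y f)⟩
      map_add' := fun f g => by
        ext t
        exact congrFun (Set.indicator_add Y (f : Γ → ℂ) (g : Γ → ℂ)) t
      map_smul' := fun c f => by
        ext t
        exact congrFun (Set.indicator_const_smul Y c (f : Γ → ℂ)) t }
    1 (by
      intro f
      rw [one_mul]
      refine (sq_le_sq₀ (norm_nonneg _) (norm_nonneg _)).1 ?_
      refine hasSum_le (fun t => ?_) (sum_sq_eq _) (sum_sq_eq f)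
      exact pow_le_pow_left₀ (norm_nonneg _) (norm_indicator_le_norm_self _ _) 2)

theorem proj_apply (Y : Set Γ) (f : L2 Γ) (t : Γ) : proj Y f t = Y.indicator f t := rfl

theorem norm_proj_le (Y : Set Γ) : ‖proj Y‖ ≤ 1 :=
  LinearMap.mkContinuous_norm_le _ zero_le_one _

/-- Strong convergence of a sequence of operators. -/
def StrongTendsto (B : ℕ → Opr Γ) (C : Opr Γ) : Prop :=
  ∀ x : L2 Γ, Tendsto (fun n => B n x) atTop (𝓝 (C x))

/-- Bounded sequences of operators on `l²(Γ)`, with the supremum norm and entrywise operations.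
An operator on `im P_Y` is identified with its extension by zero to all of `l²(Γ)`; so the
algebra of bounded sequences of operators on the spaces `im P_{Y_n}` is a
`*`-subalgebra of this one. -/
abbrev BddSeq (Γ : Type*) : Type _ := lp (fun _ : ℕ => Opr Γ) ∞

/-- The finite sections discretization `D(A) = (P_{Y_n} A P_{Y_n})`. -/
def discretize (Y : ℕ → Finset Γ) (A : Opr Γ) : BddSeq Γ :=
  ⟨fun n => proj (Y n : Set Γ) * A * proj (Y n : Set Γ), memℓp_infty ⟨‖A‖, by
    rintro _ ⟨n, rfl⟩
    have h := norm_proj_le (Y n : Set Γ)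
    calc ‖proj (Y n : Set Γ) * A * proj (Y n : Set Γ)‖
        ≤ ‖proj (Y n : Set Γ)‖ * ‖A‖ * ‖proj (Y n : Set Γ)‖ :=
          (norm_mul_le _ _).trans (by gcongr; exact norm_mul_le _ _)
      _ ≤ 1 * ‖A‖ * 1 := by gcongr
      _ = ‖A‖ := by ring⟩⟩

instance : ContinuousStar (BddSeq Γ) :=
  @NormedStarGroup.to_continuousStar (BddSeq Γ) _ _ inferInstance

/-- The finite sections algebra `S_Y(𝒜)`: the smallest closed `*`-subalgebra containing all
sequences `D(A)` with `A ∈ 𝒜`. -/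
def sectionAlgebra (Y : ℕ → Finset Γ) (𝒜 : Set (Opr Γ)) :
    NonUnitalStarSubalgebra ℂ (BddSeq Γ) :=
  NonUnitalStarSubalgebra.topologicalClosure (R := ℂ) (A := BddSeq Γ)
    (NonUnitalStarAlgebra.adjoin ℂ (discretize Y '' 𝒜))

end Operators

section Shifts

variable {Γ : Type*} [Group Γ]

/-- The left regular representation, `(L_r u)(t) = u(r⁻¹ t)`. -/
def leftShift : Γ →* Opr Γ where
  toFun r := reindex (Equiv.mulLeft r⁻¹)
  map_one' := by ext f t; simp
  map_mul' r s := by ext f t; simp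

/-- The right shifts, `(R_s f)(t) = f(t s)`; they form a representation, so `R_s⁻¹ = R_{s⁻¹}`. -/
def R : Γ →* Opr Γ where
  toFun s := reindex (Equiv.mulRight s)
  map_one' := by ext f t; simp
  map_mul' r s := by ext f t; simp [mul_assoc]

variable (Γ) in
/-- `Sh(Γ)`: the smallest closed subalgebra of the bounded operators on `l²(Γ)` which contains
all left shifts (it is unital because the shift by the identity element is the identity). -/
def Sh : Subalgebra ℂ (Opr Γ) :=
  (Algebra.adjoin ℂ (Set.range (leftShift (Γ := Γ)))).topologicalClosure

/-- `Ω_n`: the set of all words of length at most `n` with letters in `Ω`. -/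
def words (Ω : Finset Γ) (n : ℕ) : Set Γ :=
  {g | ∃ l : List Γ, l.length ≤ n ∧ (∀ a ∈ l, a ∈ Ω) ∧ l.prod = g}

/-- The `Ω`-interior of a set. -/
def interiorΩ (Ω : Finset Γ) (A : Set Γ) : Set Γ := {a ∈ A | ∀ ω ∈ Ω, ω * a ∈ A}

/-- The `Ω`-boundary of a set. -/
def boundaryΩ (Ω : Finset Γ) (A : Set Γ) : Set Γ := A \ interiorΩ Ω A

/-- `(v_n)` is an inflating sequence for `(Z_n)`: the sets `Z_n v_n⁻¹` are pairwise disjoint. -/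
def IsInflating (Z : ℕ → Set Γ) (v : ℕ → Γ) : Prop :=
  ∀ m n, m ≠ n → Disjoint (Z m * {(v m)⁻¹}) (Z n * {(v n)⁻¹})

/-- The sets `(Y_n ∪ Ω_n) (Y_n ∪ Ω_n)⁻¹ (Y_n ∪ Ω_n)`. -/
def enlarge (Ω : Finset Γ) (Y : ℕ → Finset Γ) (n : ℕ) : Set Γ :=
  ((Y n : Set Γ) ∪ words Ω n) * ((Y n : Set Γ) ∪ words Ω n)⁻¹ * ((Y n : Set Γ) ∪ words Ω n)

/-- `Γ' = Γ \ ⋃ Y_n v_n⁻¹`. -/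
def complSet (Y : ℕ → Finset Γ) (v : ℕ → Γ) : Set Γ :=
  (⋃ n, (Y n : Set Γ) * {(v n)⁻¹})ᶜ

/-- The partial sums of the series `∑ R_{v_n} A_n R_{v_n}⁻¹`. -/
def partialOp (v : ℕ → Γ) (A : ℕ → Opr Γ) (N : ℕ) : Opr Γ :=
  ∑ n ∈ Finset.range N, R (v n) * A n * R (v n)⁻¹

open Classical in
/-- `Op(A)`: the strong sum of the series `∑ R_{v_n} A_n R_{v_n}⁻¹` (and `0` if the series does
not converge strongly). -/
def Op (v : ℕ → Γ) (A : ℕ → Opr Γ) : Opr Γ :=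
  if h : ∃ T, StrongTendsto (partialOp v A) T then h.choose else 0

/-- `B` is the limit operator of `T` defined by the sequence `h`, which tends to infinity. -/
def IsLimitOperator (T : Opr Γ) (h : ℕ → Γ) (B : Opr Γ) : Prop :=
  Tendsto h atTop cofinite ∧
  StrongTendsto (fun m => R (h m)⁻¹ * T * R (h m)) B ∧
  StrongTendsto (fun m => R (h m)⁻¹ * ContinuousLinearMap.adjoint T * R (h m))
    (ContinuousLinearMap.adjoint B)

/-- `B = s-lim R_w⁻¹ R_{η_n}⁻¹ A_{k_n} R_{η_n} R_w + (P_{Γ'})_g`, both limits existing, where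
`(k_n)` is strictly increasing, `η_n` (written `η_{k_n}` in the usual notation) lies in
`(∂_Ω Y_{k_n})⁻¹`, and `g(n) = v_{k_n} η_n w`. -/
def IsBoundaryLimit (Ω : Finset Γ) (Y : ℕ → Finset Γ) (v : ℕ → Γ) (A : ℕ → Opr Γ)
    (g : ℕ → Γ) (B : Opr Γ) : Prop :=
  ∃ (k : ℕ → ℕ) (η : ℕ → Γ) (w : Γ) (C Q : Opr Γ),
    StrictMono k ∧
    (∀ n, η n ∈ (boundaryΩ Ω (Y (k n) : Set Γ))⁻¹) ∧
    (∀ n, g n = v (k n) * η n * w) ∧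
    StrongTendsto (fun n => R w⁻¹ * R (η n)⁻¹ * A (k n) * R (η n) * R w) C ∧
    IsLimitOperator (proj (complSet Y v)) g Q ∧
    B = C + Q

end Shifts

end GroupSections

end

open GroupSections

/-! Operators in `Sh` commute with every right shift, so conjugating `P_Y A P_Y` by `R_s` only
replaces `Y` by `Y s`. Hence, along any filter of pairs `(k, s)` for which each point of `Γ` is
eventually inside or eventually outside `Y_k s`, the shifted compressions converge *-strongly. Sums,
products, adjoints and norm limits inherit this, so it holds for the whole section algebra
(`exists_isStarLimit`). If the sets `Y_k s` exhaust `Γ`, the limit is always the same operator `A`;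
along an ultrafilter every point is decided, so a limit always exists.

`Op(A)` is block diagonal over the disjoint finite sets `Y_n v_n⁻¹`, and `P_{Γ'}` is the identity
off the blocks. Look at the blocks from `h(m)`, as `m` grows. If infinitely often a large ball meets
no block, for every radius, the limit operator is `I`. If infinitely often a large ball lies in one
block, for every radius, it is `A`. Otherwise some ball of fixed radius meets a block while a larger
fixed ball is not contained in it; a path of letters then crosses the boundary of that block, and
finiteness of balls gives one position `w` where this happens infinitely often. Blocks are finite
and `h` tends to infinity, so the block numbers can be taken strictly increasing. Disjointness of
the enlarged sets drives all other blocks away from every fixed point, so just one summand and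
`P_{Γ'}` survive, and compactness of the space of subsets of `Γ` makes the limit of `P_{Γ'}` exist
on a subsequence (`eq_or_exists_isBoundaryLimit`).

Conversely, `h = v` yields `A`. For `I` one needs points far from all blocks
(`exists_far_from_blocks`): without them, a neighbourhood of some block would be closed under left
multiplication by letters, hence all of the infinite group. For boundary limits the point is that
strong convergence already forces strong convergence of the adjoints (`tendsto_conj_star`). -/

namespace GroupSections

noncomputable section

/-! ### Standard basis vectors and coordinate projections. -/

section Basis

variable {Γ : Type*}

open Classical in
/-- The element `δ_t` of the standard basis of `l²(Γ)`. -/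
def delta (t : Γ) : L2 Γ := lp.single 2 t 1

theorem delta_apply_self (t : Γ) : (delta t : L2 Γ) t = 1 := by
  classical
  simp [delta]

theorem delta_apply_of_ne {t u : Γ} (h : u ≠ t) : (delta t : L2 Γ) u = 0 := by
  classical
  simp [delta, h]

theorem proj_apply_of_mem {Z : Set Γ} {t : Γ} (h : t ∈ Z) (f : L2 Γ) : proj Z f t = f t :=
  Set.indicator_of_mem h _

theorem proj_apply_of_notMem {Z : Set Γ} {t : Γ} (h : t ∉ Z) (f : L2 Γ) : proj Z f t = 0 :=
  Set.indicator_of_notMem h _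

theorem proj_delta_of_mem {Z : Set Γ} {t : Γ} (h : t ∈ Z) : proj Z (delta t) = delta t := by
  ext u
  by_cases hu : u ∈ Z
  · rw [proj_apply_of_mem hu]
  · rw [proj_apply_of_notMem hu, delta_apply_of_ne]
    rintro rfl
    exact hu h

theorem proj_delta_of_notMem {Z : Set Γ} {t : Γ} (h : t ∉ Z) : proj Z (delta t) = 0 := by
  ext u
  by_cases hu : u ∈ Z
  · rw [proj_apply_of_mem hu, delta_apply_of_ne]
    · rfl
    · rintro rfl
      exact h hu
  · rw [proj_apply_of_notMem hu]
    rfl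

theorem span_delta_dense : Dense (Submodule.span ℂ (Set.range (delta (Γ := Γ))) : Set (L2 Γ)) := by
  classical
  intro f
  refine mem_closure_of_tendsto (lp.hasSum_single (p := 2) (by norm_num) f) (.of_forall fun s => ?_)
  refine Submodule.sum_mem _ fun i _ => ?_
  have h : (lp.single 2 i (f i) : L2 Γ) = f i • delta i := by
    rw [delta, ← lp.single_smul, smul_eq_mul, mul_one]
  rw [h]
  exact Submodule.smul_mem _ _ (Submodule.subset_span ⟨i, rfl⟩)

theorem isClosed_setOf_tendsto_apply {ι : Type*} {F : Filter ι} {B : ι → Opr Γ} {C : Opr Γ} {M : ℝ}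
    (hM : ∀ i, ‖B i‖ ≤ M) : IsClosed {x : L2 Γ | Tendsto (fun i => B i x) F (𝓝 (C x))} := by
  refine Equicontinuous.isClosed_setOfPred_tendsto ?_ C.continuous
  refine (LipschitzWith.uniformEquicontinuous _ M.toNNReal fun i => ?_).equicontinuous
  refine (B i).lipschitz.weaken ?_
  rw [← NNReal.coe_le_coe]
  exact (hM i).trans (Real.le_coe_toNNReal M)

/-- For bounded families of operators, strong convergence can be checked on the standard basis. -/
theorem tendsto_of_tendsto_delta {ι : Type*} {F : Filter ι} {B : ι → Opr Γ} {C : Opr Γ} {M : ℝ}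
    (hM : ∀ i, ‖B i‖ ≤ M) (h : ∀ t, Tendsto (fun i => B i (delta t)) F (𝓝 (C (delta t))))
    (x : L2 Γ) : Tendsto (fun i => B i x) F (𝓝 (C x)) := by
  have hs : (Submodule.span ℂ (Set.range (delta (Γ := Γ))) : Set (L2 Γ)) ⊆
      {x : L2 Γ | Tendsto (fun i => B i x) F (𝓝 (C x))} := by
    intro x hx
    induction hx using Submodule.span_induction with
    | mem x hx =>
      obtain ⟨t, rfl⟩ := hx
      exact h t
    | zero => simpa using tendsto_const_nhds
    | add x y _ _ hx hy => simpa using Tendsto.add hx hy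
    | smul c x _ hx => simpa using Tendsto.const_smul hx c
  exact (isClosed_setOf_tendsto_apply hM).closure_subset_iff.2 hs (span_delta_dense x)

theorem ext_delta {B C : Opr Γ} (h : ∀ t, B (delta t) = C (delta t)) : B = C := by
  refine ContinuousLinearMap.ext fun x => ?_
  have := tendsto_of_tendsto_delta (F := (⊤ : Filter Unit)) (B := fun _ => B) (C := C)
    (M := ‖B‖) (fun _ => le_rfl) (fun t => by rw [h t]; exact tendsto_const_nhds) x
  exact tendsto_nhds_unique tendsto_const_nhds this

theorem inner_eq_zero_of_disjoint {Z W : Set Γ} (h : Disjoint Z W) (f g : L2 Γ) :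
    inner ℂ (proj Z f) (proj W g) = 0 := by
  rw [lp.inner_eq_tsum]
  refine (tsum_congr fun t => ?_).trans tsum_zero
  by_cases ht : t ∈ Z
  · rw [proj_apply_of_notMem (Set.disjoint_left.1 h ht), inner_zero_right]
  · rw [proj_apply_of_notMem ht, inner_zero_left]

theorem adjoint_proj (Z : Set Γ) : ContinuousLinearMap.adjoint (proj Z) = proj Z := by
  refine (ContinuousLinearMap.eq_adjoint_iff _ _).2 (fun f g => ?_) |>.symm
  rw [lp.inner_eq_tsum, lp.inner_eq_tsum]
  refine tsum_congr fun t => ?_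
  by_cases ht : t ∈ Z
  · rw [proj_apply_of_mem ht, proj_apply_of_mem ht]
  · rw [proj_apply_of_notMem ht, proj_apply_of_notMem ht, inner_zero_left, inner_zero_right]

theorem proj_mul_proj (Z W : Set Γ) : proj Z * proj W = proj (Z ∩ W) := by
  refine ext_delta fun t => ?_
  change proj Z (proj W (delta t)) = _
  by_cases hW : t ∈ W
  · rw [proj_delta_of_mem hW]
    by_cases hZ : t ∈ Z
    · rw [proj_delta_of_mem hZ, proj_delta_of_mem (show t ∈ Z ∩ W from ⟨hZ, hW⟩)]
    · rw [proj_delta_of_notMem hZ, proj_delta_of_notMem fun h : t ∈ Z ∩ W => hZ h.1]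
  · rw [proj_delta_of_notMem hW, proj_delta_of_notMem fun h : t ∈ Z ∩ W => hW h.2, map_zero]

theorem proj_union {Z W : Set Γ} (h : Disjoint Z W) : proj (Z ∪ W) = proj Z + proj W := by
  refine ext_delta fun t => ?_
  change _ = proj Z (delta t) + proj W (delta t)
  by_cases hZ : t ∈ Z
  · rw [proj_delta_of_mem hZ, proj_delta_of_mem (show t ∈ Z ∪ W from Or.inl hZ),
      proj_delta_of_notMem (Set.disjoint_left.1 h hZ), add_zero]
  · rw [proj_delta_of_notMem hZ, zero_add]
    by_cases hW : t ∈ W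
    · rw [proj_delta_of_mem hW, proj_delta_of_mem (show t ∈ Z ∪ W from Or.inr hW)]
    · rw [proj_delta_of_notMem hW, proj_delta_of_notMem fun h : t ∈ Z ∪ W => h.elim hZ hW]

theorem norm_sq_proj_union {Z W : Set Γ} (h : Disjoint Z W) (f : L2 Γ) :
    ‖proj (Z ∪ W) f‖ ^ 2 = ‖proj Z f‖ ^ 2 + ‖proj W f‖ ^ 2 := by
  have h₁ : proj (Z ∪ W) f = proj Z f + proj W f := by rw [proj_union h]; rfl
  rw [h₁, sq, sq, sq, norm_add_sq_eq_norm_sq_add_norm_sq_of_inner_eq_zero (𝕜 := ℂ) _ _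
    (inner_eq_zero_of_disjoint h f f)]

end Basis

/-! ### Conjugation by right shifts. -/

section Shift

variable {Γ : Type*} [Group Γ]

theorem R_apply (s : Γ) (f : L2 Γ) (t : Γ) : R s f t = f (t * s) := rfl

theorem R_delta (s t : Γ) : R s (delta t) = delta (t * s⁻¹) := by
  ext u
  rw [R_apply]
  by_cases h : u = t * s⁻¹
  · subst h
    rw [inv_mul_cancel_right, delta_apply_self, delta_apply_self]
  · rw [delta_apply_of_ne h, delta_apply_of_ne]
    rintro rfl
    simp at h

theorem R_inv_mul_R (s : Γ) : R s⁻¹ * R s = (1 : Opr Γ) := by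
  rw [← map_mul, inv_mul_cancel, map_one]

theorem R_mul_R_inv (s : Γ) : R s * R s⁻¹ = (1 : Opr Γ) := by
  rw [← map_mul, mul_inv_cancel, map_one]

theorem norm_R_le (s : Γ) : ‖R s‖ ≤ 1 := by
  refine ContinuousLinearMap.opNorm_le_bound _ zero_le_one fun f => ?_
  rw [one_mul]
  refine le_of_eq ((sq_eq_sq₀ (norm_nonneg _) (norm_nonneg _)).1 ?_)
  exact (sum_sq_eq (R s f)).unique (((Equiv.mulRight s).hasSum_iff).2 (sum_sq_eq f))

theorem adjoint_R (s : Γ) : ContinuousLinearMap.adjoint (R s) = R s⁻¹ := by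
  refine (ContinuousLinearMap.eq_adjoint_iff _ _).2 (fun f g => ?_) |>.symm
  rw [lp.inner_eq_tsum, lp.inner_eq_tsum, ← (Equiv.mulRight s).tsum_eq]
  refine tsum_congr fun t => ?_
  simp [R_apply]

/-- The operator `R_s⁻¹ T R_s`. -/
def conj (s : Γ) (T : Opr Γ) : Opr Γ := R s⁻¹ * T * R s

theorem conj_delta (s t : Γ) (T : Opr Γ) :
    conj s T (delta t) = R s⁻¹ (T (delta (t * s⁻¹))) := by
  change R s⁻¹ (T (R s (delta t))) = _
  rw [R_delta]

theorem norm_conj_le (s : Γ) (T : Opr Γ) : ‖conj s T‖ ≤ ‖T‖ := by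
  have h₁ := norm_R_le s
  have h₂ := norm_R_le s⁻¹
  calc ‖conj s T‖ ≤ ‖R s⁻¹‖ * ‖T‖ * ‖R s‖ :=
        (norm_mul_le _ _).trans (by gcongr; exact norm_mul_le _ _)
    _ ≤ 1 * ‖T‖ * 1 := by gcongr
    _ = ‖T‖ := by ring

theorem conj_add (s : Γ) (S T : Opr Γ) : conj s (S + T) = conj s S + conj s T := by
  simp only [conj, mul_add, add_mul]

theorem conj_sub (s : Γ) (S T : Opr Γ) : conj s (S - T) = conj s S - conj s T := by
  simp only [conj, mul_sub, sub_mul]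

theorem conj_smul (s : Γ) (c : ℂ) (T : Opr Γ) : conj s (c • T) = c • conj s T := by
  simp only [conj, mul_smul_comm, smul_mul_assoc]

theorem conj_mul (s : Γ) (S T : Opr Γ) : conj s (S * T) = conj s S * conj s T := by
  simp only [conj, mul_assoc]
  rw [← mul_assoc (R s) (R s⁻¹), R_mul_R_inv, one_mul]

theorem conj_conj (s t : Γ) (T : Opr Γ) : conj t (conj s T) = conj (s * t) T := by
  simp only [conj, mul_inv_rev, map_mul, mul_assoc]

theorem conj_one_left (T : Opr Γ) : conj 1 T = T := by
  simp [conj]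

theorem adjoint_conj (s : Γ) (T : Opr Γ) :
    ContinuousLinearMap.adjoint (conj s T) = conj s (ContinuousLinearMap.adjoint T) := by
  have h : ∀ S : Opr Γ, ContinuousLinearMap.adjoint S = star S := fun _ => rfl
  have h' : ∀ t : Γ, star (R t) = R t⁻¹ := adjoint_R
  simp only [conj, h, star_mul, h', inv_inv, mul_assoc]

theorem conj_proj (s : Γ) (Z : Set Γ) : conj s (proj Z) = proj {t | t * s⁻¹ ∈ Z} := by
  refine ext_delta fun t => ?_
  rw [conj_delta]
  by_cases h : t * s⁻¹ ∈ Z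
  · rw [proj_delta_of_mem h, proj_delta_of_mem (show t ∈ {t | t * s⁻¹ ∈ Z} from h), R_delta]
    simp
  · rw [proj_delta_of_notMem h, proj_delta_of_notMem (show t ∉ {t | t * s⁻¹ ∈ Z} from h), map_zero]

/-- Left and right multiplications commute, and a centralizer is a closed subalgebra. -/
theorem commute_R_of_mem_Sh {A : Opr Γ} (hA : A ∈ Sh Γ) (s : Γ) : A * R s = R s * A := by
  have h : Sh Γ ≤ Subalgebra.centralizer ℂ (Set.range (R (Γ := Γ))) := by
    refine Subalgebra.topologicalClosure_minimal (Algebra.adjoin_le ?_)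
      (Set.isClosed_centralizer _)
    rintro _ ⟨r, rfl⟩
    rw [SetLike.mem_coe, Subalgebra.mem_centralizer_iff]
    rintro _ ⟨u, rfl⟩
    ext f t
    change f (r⁻¹ * (t * u)) = f (r⁻¹ * t * u)
    rw [mul_assoc]
  exact ((Subalgebra.mem_centralizer_iff ℂ).1 (h hA) _ ⟨s, rfl⟩).symm

theorem conj_of_mem_Sh {A : Opr Γ} (hA : A ∈ Sh Γ) (s : Γ) : conj s A = A := by
  rw [conj, mul_assoc, commute_R_of_mem_Sh hA, ← mul_assoc, R_inv_mul_R, one_mul]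

end Shift

end

end GroupSections

namespace GroupSections

noncomputable section

/-! ### Strong limits and induction over the section algebra. -/

section Limits

variable {Γ : Type*}

theorem tendsto_of_norm_sub_le {ι E : Type*} [NormedAddCommGroup E] {F : Filter ι}
    {f : ℕ → ι → E} {a : ℕ → E} {g : ι → E} {b : E} {ε : ℕ → ℝ}
    (hε : Tendsto ε atTop (𝓝 0)) (hfg : ∀ j i, ‖f j i - g i‖ ≤ ε j)
    (hf : ∀ j, Tendsto (f j) F (𝓝 (a j))) (ha : Tendsto a atTop (𝓝 b)) :
    Tendsto g F (𝓝 b) := by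
  rw [Metric.tendsto_nhds]
  intro r hr
  obtain ⟨j, hj₁, hj₂⟩ := ((hε.eventually_lt_const (show 0 < r / 3 by positivity)).and
    (Metric.tendsto_nhds.1 ha (r / 3) (by positivity))).exists
  filter_upwards [Metric.tendsto_nhds.1 (hf j) (r / 3) (by positivity)] with i hi
  have h₁ : dist (g i) (f j i) ≤ ε j := by
    rw [dist_comm, dist_eq_norm]
    exact hfg j i
  linarith [dist_triangle (g i) (f j i) b, dist_triangle (f j i) (a j) b]

theorem tendsto_mul_apply {ι : Type*} {F : Filter ι} {B C : ι → Opr Γ} {B' C' : Opr Γ} {M : ℝ}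
    (hM : ∀ i, ‖B i‖ ≤ M) (hB : ∀ x, Tendsto (fun i => B i x) F (𝓝 (B' x)))
    (hC : ∀ x, Tendsto (fun i => C i x) F (𝓝 (C' x))) (x : L2 Γ) :
    Tendsto (fun i => (B i * C i) x) F (𝓝 ((B' * C') x)) := by
  have h₁ : Tendsto (fun i => B i (C i x - C' x)) F (𝓝 0) := by
    have h₂ : Tendsto (fun i => M * ‖C i x - C' x‖) F (𝓝 0) := by
      simpa using (tendsto_iff_norm_sub_tendsto_zero.1 (hC x)).const_mul M
    exact squeeze_zero_norm (fun i => (B i).le_of_opNorm_le (hM i) _) h₂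
  have h₃ := h₁.add (hB (C' x))
  rw [zero_add] at h₃
  refine h₃.congr fun i => ?_
  rw [map_sub, sub_add_cancel]
  rfl

theorem eq_star_of_tendsto {ι : Type*} {F : Filter ι} [NeBot F] {B : ι → Opr Γ} {C D : Opr Γ}
    (hB : ∀ x, Tendsto (fun i => B i x) F (𝓝 (C x)))
    (hB' : ∀ x, Tendsto (fun i => star (B i) x) F (𝓝 (D x))) : D = star C := by
  refine (ContinuousLinearMap.eq_adjoint_iff _ _).2 fun x y => ?_
  refine tendsto_nhds_unique ((hB' x).inner (tendsto_const_nhds (x := y)))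
    (((tendsto_const_nhds (x := x)).inner (hB y)).congr fun i => ?_)
  exact (ContinuousLinearMap.adjoint_inner_left (B i) y x).symm

theorem norm_apply_le (A : BddSeq Γ) (n : ℕ) : ‖A n‖ ≤ ‖A‖ :=
  lp.norm_apply_le_norm ENNReal.top_ne_zero A n

variable {Y : ℕ → Finset Γ}

theorem sectionAlgebra_induction {𝒜 : Set (Opr Γ)} {p : BddSeq Γ → Prop}
    (hclosed : IsClosed {A | p A}) (hgen : ∀ A ∈ 𝒜, p (discretize Y A)) (hzero : p 0)
    (hadd : ∀ A B, p A → p B → p (A + B)) (hmul : ∀ A B, p A → p B → p (A * B))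
    (hsmul : ∀ (c : ℂ) A, p A → p (c • A)) (hstar : ∀ A, p A → p (star A))
    {A : BddSeq Γ} (hA : A ∈ sectionAlgebra Y 𝒜) : p A := by
  let S : NonUnitalStarSubalgebra ℂ (BddSeq Γ) :=
    { carrier := {A | p A}
      add_mem' := fun {A B} => hadd A B
      zero_mem' := hzero
      mul_mem' := fun {A B} => hmul A B
      smul_mem' := fun c A => hsmul c A
      star_mem' := fun {A} => hstar A }
  have h : sectionAlgebra Y 𝒜 ≤ S := by
    refine NonUnitalStarSubalgebra.topologicalClosure_minimal _ (NonUnitalStarAlgebra.adjoin_le ?_)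
      hclosed
    rintro _ ⟨A, hA, rfl⟩
    exact hgen A hA
  exact h hA

theorem star_discretize (A : Opr Γ) : star (discretize Y A) = discretize Y (star A) := by
  have h : ∀ Z : Set Γ, star (proj Z) = proj Z := adjoint_proj
  ext1
  funext n
  change star (proj (Y n : Set Γ) * A * proj (Y n : Set Γ)) =
    proj (Y n : Set Γ) * star A * proj (Y n : Set Γ)
  rw [star_mul, star_mul, h, mul_assoc]

/-- Recovers that the entries, which are operators on all of `l²(Γ)`, live on `l²(Y_n)`. This is
what makes `Op(A)` block diagonal. -/
theorem proj_mul_apply_mul_proj {𝒜 : Set (Opr Γ)} {A : BddSeq Γ} (hA : A ∈ sectionAlgebra Y 𝒜)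
    (n : ℕ) : proj (Y n : Set Γ) * A n = A n ∧ A n * proj (Y n : Set Γ) = A n := by
  have hP : proj (Y n : Set Γ) * proj (Y n : Set Γ) = proj (Y n : Set Γ) := by
    rw [proj_mul_proj, Set.inter_self]
  have hstar : star (proj (Y n : Set Γ)) = proj (Y n : Set Γ) := adjoint_proj _
  refine sectionAlgebra_induction
    (p := fun A => proj (Y n : Set Γ) * A n = A n ∧ A n * proj (Y n : Set Γ) = A n)
    ?_ ?_ ?_ ?_ ?_ ?_ ?_ hA
  · have hc : Continuous fun A : BddSeq Γ => A n := by
      refine (LipschitzWith.of_dist_le_mul (K := 1) fun A B => ?_).continuous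
      rw [NNReal.coe_one, one_mul, dist_eq_norm, dist_eq_norm, ← Pi.sub_apply, ← lp.coeFn_sub]
      exact norm_apply_le _ _
    exact (isClosed_eq (continuous_const.mul hc) hc).inter
      (isClosed_eq (hc.mul continuous_const) hc)
  · intro A _
    change proj (Y n : Set Γ) * (proj (Y n : Set Γ) * A * proj (Y n : Set Γ)) =
      proj (Y n : Set Γ) * A * proj (Y n : Set Γ) ∧
      proj (Y n : Set Γ) * A * proj (Y n : Set Γ) * proj (Y n : Set Γ) =
      proj (Y n : Set Γ) * A * proj (Y n : Set Γ)
    rw [mul_assoc _ (proj (Y n : Set Γ)) (proj (Y n : Set Γ)), hP, ← mul_assoc, ← mul_assoc, hP]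
    exact ⟨rfl, rfl⟩
  · rw [lp.coeFn_zero, Pi.zero_apply, mul_zero, zero_mul]
    exact ⟨rfl, rfl⟩
  · rintro A B ⟨h₁, h₂⟩ ⟨h₃, h₄⟩
    rw [lp.coeFn_add, Pi.add_apply, mul_add, add_mul, h₁, h₂, h₃, h₄]
    exact ⟨rfl, rfl⟩
  · rintro A B ⟨h₁, h₂⟩ ⟨h₃, h₄⟩
    rw [lp.infty_coeFn_mul, Pi.mul_apply, ← mul_assoc, h₁, mul_assoc, h₄]
    exact ⟨rfl, rfl⟩
  · rintro c A ⟨h₁, h₂⟩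
    rw [lp.coeFn_smul, Pi.smul_apply, mul_smul_comm, smul_mul_assoc, h₁, h₂]
    exact ⟨rfl, rfl⟩
  · rintro A ⟨h₁, h₂⟩
    rw [lp.coeFn_star, Pi.star_apply]
    constructor
    · conv_rhs => rw [← h₂, star_mul, hstar]
    · conv_rhs => rw [← h₁, star_mul, hstar]

theorem star_mem_sectionAlgebra {𝒜 : Set (Opr Γ)} {A : BddSeq Γ} (hA : A ∈ sectionAlgebra Y 𝒜) :
    star A ∈ sectionAlgebra Y 𝒜 :=
  star_mem hA

end Limits

/-! ### *-strong limits of shifted sequences. -/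

section StarLimit

variable {Γ : Type*} [Group Γ] {Y : ℕ → Finset Γ}

/-- Along `F`, the operators `R_s⁻¹ A_k R_s` and their adjoints converge strongly to `L` and its
adjoint. -/
def IsStarLimit (F : Filter (ℕ × Γ)) (A : ℕ → Opr Γ) (L : Opr Γ) : Prop :=
  ∀ x, Tendsto (fun p : ℕ × Γ => conj p.2 (A p.1) x) F (𝓝 (L x)) ∧
    Tendsto (fun p : ℕ × Γ => conj p.2 (star (A p.1)) x) F (𝓝 (star L x))

theorem IsStarLimit.star {F : Filter (ℕ × Γ)} {A : BddSeq Γ} {L : Opr Γ} (h : IsStarLimit F A L) :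
    IsStarLimit F (star A : BddSeq Γ) (star L) := by
  intro x
  refine ⟨(h x).2, ?_⟩
  simpa using (h x).1

theorem IsStarLimit.add {F : Filter (ℕ × Γ)} {A B : BddSeq Γ} {K L : Opr Γ}
    (hA : IsStarLimit F A K) (hB : IsStarLimit F B L) :
    IsStarLimit F (A + B : BddSeq Γ) (K + L) := by
  intro x
  constructor
  · refine ((hA x).1.add (hB x).1).congr fun p => ?_
    rw [lp.coeFn_add, Pi.add_apply, conj_add]
    rfl
  · rw [star_add]
    refine ((hA x).2.add (hB x).2).congr fun p => ?_
    rw [lp.coeFn_add, Pi.add_apply, star_add, conj_add]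
    rfl

theorem IsStarLimit.smul {F : Filter (ℕ × Γ)} {A : BddSeq Γ} {L : Opr Γ} (c : ℂ)
    (hA : IsStarLimit F A L) : IsStarLimit F (c • A : BddSeq Γ) (c • L) := by
  intro x
  constructor
  · refine ((hA x).1.const_smul c).congr fun p => ?_
    rw [lp.coeFn_smul, Pi.smul_apply, conj_smul]
    rfl
  · rw [star_smul]
    refine ((hA x).2.const_smul (Star.star c)).congr fun p => ?_
    rw [lp.coeFn_smul, Pi.smul_apply, star_smul, conj_smul]
    rfl

theorem IsStarLimit.mul {F : Filter (ℕ × Γ)} {A B : BddSeq Γ} {K L : Opr Γ}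
    (hA : IsStarLimit F A K) (hB : IsStarLimit F B L) :
    IsStarLimit F (A * B : BddSeq Γ) (K * L) := by
  intro x
  constructor
  · refine (tendsto_mul_apply (M := ‖A‖) (fun p => (norm_conj_le _ _).trans (norm_apply_le A _))
      (fun y => (hA y).1) (fun y => (hB y).1) x).congr fun p => ?_
    rw [lp.infty_coeFn_mul, Pi.mul_apply, conj_mul]
  · rw [star_mul]
    refine (tendsto_mul_apply (M := ‖B‖)
      (fun p => (norm_conj_le _ _).trans ((norm_star _).trans_le (norm_apply_le B _)))
      (fun y => (hB y).2) (fun y => (hA y).2) x).congr fun p => ?_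
    rw [lp.infty_coeFn_mul, Pi.mul_apply, star_mul, conj_mul]

/-- Norms do not increase under strong limits, so a norm convergent sequence of sequences has a
Cauchy sequence of limit operators. The trivial filter is treated apart, since that estimate needs a
nontrivial one. -/
theorem isClosed_setOf_exists_isStarLimit (F : Filter (ℕ × Γ)) :
    IsClosed {A : BddSeq Γ | ∃ L, IsStarLimit F A L} := by
  rcases F.eq_or_neBot with rfl | hF
  · convert isClosed_univ
    exact Set.eq_univ_of_forall fun A => ⟨0, fun x => ⟨tendsto_bot, tendsto_bot⟩⟩
  refine isClosed_of_closure_subset fun A hA => ?_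
  obtain ⟨a, ha, hlim⟩ := mem_closure_iff_seq_limit.1 hA
  choose L hL using ha
  have hsub : ∀ i j, ‖L i - L j‖ ≤ ‖a i - a j‖ := by
    intro i j
    refine ContinuousLinearMap.opNorm_le_bound _ (norm_nonneg _) fun x => ?_
    refine le_of_tendsto ((((hL i) x).1.sub ((hL j) x).1).norm) (.of_forall fun p => ?_)
    have h : conj p.2 (a i p.1) x - conj p.2 (a j p.1) x = conj p.2 ((a i - a j) p.1) x := by
      rw [lp.coeFn_sub, Pi.sub_apply, conj_sub]
      rfl
    rw [h]
    exact (conj p.2 ((a i - a j) p.1)).le_of_opNorm_le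
      ((norm_conj_le _ _).trans (norm_apply_le _ _)) x
  have hcau : CauchySeq L := by
    rw [Metric.cauchySeq_iff]
    intro ε hε
    obtain ⟨N, hN⟩ := Metric.cauchySeq_iff.1 hlim.cauchySeq ε hε
    refine ⟨N, fun m hm n hn => lt_of_le_of_lt ?_ (hN m hm n hn)⟩
    rw [dist_eq_norm, dist_eq_norm]
    exact hsub m n
  obtain ⟨K, hK⟩ := cauchySeq_tendsto_of_complete hcau
  have happly : ∀ {f : ℕ → Opr Γ} {g : Opr Γ}, Tendsto f atTop (𝓝 g) → ∀ x,
      Tendsto (fun j => f j x) atTop (𝓝 (g x)) := fun hf x =>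
    (((ContinuousLinearMap.apply ℂ (L2 Γ)) x).continuous.tendsto _).comp hf
  refine ⟨K, fun x => ?_⟩
  have hε : Tendsto (fun j => ‖a j - A‖ * ‖x‖) atTop (𝓝 0) := by
    simpa using (tendsto_iff_norm_sub_tendsto_zero.1 hlim).mul_const ‖x‖
  constructor
  · refine tendsto_of_norm_sub_le hε (fun j p => ?_) (fun j => (hL j x).1) (happly hK x)
    have h : conj p.2 (a j p.1) x - conj p.2 (A p.1) x = conj p.2 ((a j - A) p.1) x := by
      rw [lp.coeFn_sub, Pi.sub_apply, conj_sub]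
      rfl
    rw [h]
    exact (conj p.2 ((a j - A) p.1)).le_of_opNorm_le
      ((norm_conj_le _ _).trans (norm_apply_le _ _)) x
  · refine tendsto_of_norm_sub_le hε (fun j p => ?_) (fun j => (hL j x).2) (happly hK.star x)
    have h : conj p.2 (star (a j p.1)) x - conj p.2 (star (A p.1)) x =
        conj p.2 (star ((a j - A) p.1)) x := by
      rw [lp.coeFn_sub, Pi.sub_apply, star_sub, conj_sub]
      rfl
    rw [h]
    exact (conj p.2 (star ((a j - A) p.1))).le_of_opNorm_le
      ((norm_conj_le _ _).trans ((norm_star _).trans_le (norm_apply_le _ _))) x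

/-- The hypothesis says that the indicator functions of the sets `Y_k s` converge pointwise along
`F`; by shift invariance of `Sh` nothing else can obstruct convergence. -/
theorem exists_isStarLimit {F : Filter (ℕ × Γ)}
    (hF : ∀ t, (∀ᶠ p in F, t * p.2⁻¹ ∈ Y p.1) ∨ ∀ᶠ p in F, t * p.2⁻¹ ∉ Y p.1)
    {A : BddSeq Γ} (hA : A ∈ sectionAlgebra Y (Sh Γ : Set (Opr Γ))) :
    ∃ L, IsStarLimit F A L := by
  refine sectionAlgebra_induction (p := fun A => ∃ L, IsStarLimit F A L)
    (isClosed_setOf_exists_isStarLimit F) ?_ ?_ ?_ ?_ ?_ ?_ hA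
  · intro A hA
    set Z : Set Γ := {t | ∀ᶠ p in F, t * p.2⁻¹ ∈ Y p.1}
    have hP : ∀ x, Tendsto (fun p : ℕ × Γ => conj p.2 (proj (Y p.1 : Set Γ)) x) F
        (𝓝 (proj Z x)) := by
      refine tendsto_of_tendsto_delta (M := 1) (fun p => (norm_conj_le _ _).trans (norm_proj_le _))
        fun t => ?_
      rcases hF t with h | h
      · rw [proj_delta_of_mem (show t ∈ Z from h)]
        refine tendsto_const_nhds.congr' ?_
        filter_upwards [h] with p hp
        rw [conj_proj, proj_delta_of_mem]
        exact hp
      -- The two alternatives exclude each other only if `F` is nontrivial.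
      · by_cases hZ : t ∈ Z
        · have hbot : F = ⊥ := by
            rw [← Filter.eventually_false_iff_eq_bot]
            filter_upwards [h, (show ∀ᶠ p in F, t * p.2⁻¹ ∈ Y p.1 from hZ)] with p h₁ h₂
            exact h₁ h₂
          rw [hbot]
          exact tendsto_bot
        · rw [proj_delta_of_notMem hZ]
          refine tendsto_const_nhds.congr' ?_
          filter_upwards [h] with p hp
          rw [conj_proj, proj_delta_of_notMem]
          exact hp
    -- Only shift invariance of `B` is asked for, so that `star A` is covered without showing that
    -- it belongs to `Sh`.
    have key : ∀ B : Opr Γ, (∀ s : Γ, conj s B = B) → ∀ x,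
        Tendsto (fun p : ℕ × Γ => conj p.2 (discretize Y B p.1) x) F
          (𝓝 ((proj Z * B * proj Z) x)) := by
      intro B hB x
      refine (tendsto_mul_apply (M := ‖B‖) (fun p => ?_)
        (tendsto_mul_apply (C := fun p : ℕ × Γ => conj p.2 B) (M := 1)
          (fun p => (norm_conj_le _ _).trans (norm_proj_le _)) hP fun y => ?_) hP x).congr
        fun p => ?_
      · refine (norm_mul_le _ _).trans ?_
        have h₁ := (norm_conj_le p.2 _).trans (norm_proj_le (Y p.1 : Set Γ))
        have h₂ := norm_conj_le p.2 B
        calc _ ≤ 1 * ‖B‖ := by gcongr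
          _ = ‖B‖ := one_mul _
      · simp only [hB]
        exact tendsto_const_nhds
      · rw [← conj_mul, ← conj_mul]
        rfl
    have hA' : ∀ s : Γ, conj s (star A) = star A := fun s =>
      (adjoint_conj s A).symm.trans (congrArg star (conj_of_mem_Sh hA s))
    refine ⟨proj Z * A * proj Z, fun x => ⟨key A (conj_of_mem_Sh hA) x, ?_⟩⟩
    have hstar : ∀ W : Set Γ, star (proj W) = proj W := adjoint_proj
    have h := key (star A) hA' x
    rw [star_mul, star_mul, hstar, ← mul_assoc]
    refine h.congr fun p => ?_
    rw [← star_discretize]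
    rfl
  · refine ⟨0, fun x => ?_⟩
    simpa [conj] using tendsto_const_nhds
  · rintro A B ⟨K, hK⟩ ⟨L, hL⟩
    exact ⟨_, hK.add hL⟩
  · rintro A B ⟨K, hK⟩ ⟨L, hL⟩
    exact ⟨_, hK.mul hL⟩
  · rintro c A ⟨L, hL⟩
    exact ⟨_, hL.smul c⟩
  · rintro A ⟨L, hL⟩
    exact ⟨_, hL.star⟩

end StarLimit

end

end GroupSections

namespace GroupSections

noncomputable section

/-! ### Strong convergence from convergence on the basis. -/

section Convergence

variable {Γ : Type*}

theorem exists_strongTendsto {B : ℕ → Opr Γ} {M : ℝ} (hM : ∀ n, ‖B n‖ ≤ M)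
    (h : ∀ t, ∃ y, Tendsto (fun n => B n (delta t)) atTop (𝓝 y)) : ∃ C, StrongTendsto B C := by
  have hM₀ : 0 ≤ M := (norm_nonneg _).trans (hM 0)
  have hspan : ∀ x ∈ Submodule.span ℂ (Set.range (delta (Γ := Γ))),
      ∃ y, Tendsto (fun n => B n x) atTop (𝓝 y) := by
    intro x hx
    induction hx using Submodule.span_induction with
    | mem x hx =>
      obtain ⟨t, rfl⟩ := hx
      exact h t
    | zero => exact ⟨0, by simp⟩
    | add x y _ _ hx hy =>
      obtain ⟨a, ha⟩ := hx
      obtain ⟨b, hb⟩ := hy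
      exact ⟨a + b, by simpa using ha.add hb⟩
    | smul c x _ hx =>
      obtain ⟨a, ha⟩ := hx
      exact ⟨c • a, by simpa using ha.const_smul c⟩
  have hall : ∀ x, ∃ y, Tendsto (fun n => B n x) atTop (𝓝 y) := by
    intro x
    refine cauchySeq_tendsto_of_complete (Metric.cauchySeq_iff.2 fun ε hε => ?_)
    obtain ⟨z, hz, hxz⟩ := Metric.mem_closure_iff.1 (span_delta_dense x) (ε / (3 * (M + 1)))
      (by positivity)
    obtain ⟨y, hy⟩ := hspan z hz
    obtain ⟨N, hN⟩ := Metric.cauchySeq_iff.1 hy.cauchySeq (ε / 3) (by positivity)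
    have hB : ∀ n, dist (B n x) (B n z) < ε / 3 := by
      intro n
      rw [dist_eq_norm, ← map_sub]
      rw [dist_eq_norm, lt_div_iff₀ (by positivity)] at hxz
      have h₁ := (B n).le_of_opNorm_le (hM n) (x - z)
      nlinarith [norm_nonneg (x - z)]
    refine ⟨N, fun m hm n hn => ?_⟩
    have h₁ := hB n
    rw [dist_comm] at h₁
    linarith [hB m, hN m hm n hn, dist_triangle (B m x) (B m z) (B n x),
      dist_triangle (B m z) (B n z) (B n x)]
  choose y hy using hall
  exact ⟨continuousLinearMapOfTendsto B (tendsto_pi_nhds.2 hy), hy⟩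

end Convergence

/-! ### The block diagonal operator `Op(A)` and its shifts. -/

section Op

variable {Γ : Type*} [Group Γ]

/-- The set `Y_n v_n⁻¹`. -/
def block (Y : ℕ → Finset Γ) (v : ℕ → Γ) (n : ℕ) : Set Γ := {t | t * v n ∈ Y n}

theorem mul_singleton_inv_eq (Z : Set Γ) (s : Γ) : Z * {s⁻¹} = {t | t * s ∈ Z} := by
  ext t
  rw [Set.mul_singleton, Set.mem_image]
  exact ⟨by rintro ⟨z, hz, rfl⟩; simpa using hz, fun h => ⟨t * s, h, by simp⟩⟩

variable {Y : ℕ → Finset Γ} {v : ℕ → Γ} {𝒜 : Set (Opr Γ)} {A : BddSeq Γ}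

theorem finite_block (n : ℕ) : (block Y v n).Finite :=
  ((Y n).finite_toSet.preimage (mul_left_injective (v n)).injOn :)

theorem mem_complSet {t : Γ} : t ∈ complSet Y v ↔ ∀ n, t ∉ block Y v n := by
  simp only [complSet, mul_singleton_inv_eq, Set.mem_compl_iff, Set.mem_iUnion, not_exists]
  rfl

theorem partialOp_eq (v : ℕ → Γ) (A : ℕ → Opr Γ) (N : ℕ) :
    partialOp v A N = ∑ n ∈ Finset.range N, conj (v n)⁻¹ (A n) := by
  simp only [partialOp, conj, inv_inv]

theorem star_partialOp (v : ℕ → Γ) (A : BddSeq Γ) (N : ℕ) :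
    star (partialOp v A N) = partialOp v (star A : BddSeq Γ) N := by
  rw [partialOp_eq, partialOp_eq, star_sum]
  exact Finset.sum_congr rfl fun n _ => adjoint_conj _ _

theorem proj_block_eq (n : ℕ) : proj (block Y v n) = conj (v n)⁻¹ (proj (Y n : Set Γ)) := by
  rw [conj_proj]
  simp only [inv_inv]
  rfl

theorem proj_block_mul_conj (hA : A ∈ sectionAlgebra Y 𝒜) (n : ℕ) :
    proj (block Y v n) * conj (v n)⁻¹ (A n) = conj (v n)⁻¹ (A n) := by
  rw [proj_block_eq, ← conj_mul, (proj_mul_apply_mul_proj hA n).1]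

theorem conj_mul_proj_block (hA : A ∈ sectionAlgebra Y 𝒜) (n : ℕ) :
    conj (v n)⁻¹ (A n) * proj (block Y v n) = conj (v n)⁻¹ (A n) := by
  rw [proj_block_eq, ← conj_mul, (proj_mul_apply_mul_proj hA n).2]

theorem conj_delta_of_notMem_block (hA : A ∈ sectionAlgebra Y 𝒜) {n : ℕ} {u : Γ}
    (hu : u ∉ block Y v n) : conj (v n)⁻¹ (A n) (delta u) = 0 := by
  rw [← conj_mul_proj_block hA]
  change conj (v n)⁻¹ (A n) (proj (block Y v n) (delta u)) = 0
  rw [proj_delta_of_notMem hu, map_zero]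

theorem partialOp_delta (hA : A ∈ sectionAlgebra Y 𝒜) {n N : ℕ} (hN : n < N) {u : Γ}
    (hu : ∀ j, j ≠ n → u ∉ block Y v j) :
    partialOp v A N (delta u) = conj (v n)⁻¹ (A n) (delta u) := by
  rw [partialOp_eq, sum_apply]
  exact Finset.sum_eq_single n (fun j _ hj => conj_delta_of_notMem_block hA (hu j hj))
    fun h => (h (Finset.mem_range.2 hN)).elim

theorem tendsto_partialOp_delta (hA : A ∈ sectionAlgebra Y 𝒜) {n : ℕ} {u : Γ}
    (hu : ∀ j, j ≠ n → u ∉ block Y v j) :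
    Tendsto (fun N => partialOp v A N (delta u)) atTop (𝓝 (conj (v n)⁻¹ (A n) (delta u))) := by
  refine tendsto_const_nhds.congr' ?_
  filter_upwards [eventually_gt_atTop n] with N hN
  exact (partialOp_delta hA hN hu).symm

theorem norm_partialOp_le (hA : A ∈ sectionAlgebra Y 𝒜)
    (hdisj : Pairwise fun m n => Disjoint (block Y v m) (block Y v n)) (N : ℕ) :
    ‖partialOp v A N‖ ≤ ‖A‖ := by
  refine ContinuousLinearMap.opNorm_le_bound _ (norm_nonneg _) fun f => ?_
  -- The induction carries the support of the partial sum along with the squared estimate: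
  -- orthogonality to the next block is what Pythagoras needs.
  suffices h : proj (⋃ n ∈ Finset.range N, block Y v n) (partialOp v A N f) = partialOp v A N f ∧
      ‖partialOp v A N f‖ ^ 2 ≤
        ‖A‖ ^ 2 * ‖proj (⋃ n ∈ Finset.range N, block Y v n) f‖ ^ 2 by
    refine (sq_le_sq₀ (norm_nonneg _) (by positivity)).1 (h.2.trans ?_)
    rw [mul_pow]
    gcongr
    exact ((proj _).le_of_opNorm_le (norm_proj_le _) f).trans_eq (one_mul _)
  induction N with
  | zero =>
    have h₀ : partialOp v A 0 f = 0 := by simp [partialOp]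
    rw [h₀, map_zero, norm_zero, zero_pow two_ne_zero]
    exact ⟨rfl, by positivity⟩
  | succ N ih =>
    set U := ⋃ n ∈ Finset.range N, block Y v n with hU
    have hU' : (⋃ n ∈ Finset.range (N + 1), block Y v n) = U ∪ block Y v N := by
      rw [Finset.range_add_one, Finset.set_biUnion_insert, Set.union_comm]
    have hd : Disjoint U (block Y v N) := by
      simp only [hU, Set.disjoint_iUnion_left]
      exact fun n hn => hdisj (Finset.mem_range.1 hn).ne
    have hT : proj (block Y v N) (conj (v N)⁻¹ (A N) f) = conj (v N)⁻¹ (A N) f :=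
      congrArg (fun T : Opr Γ => T f) (proj_block_mul_conj hA N)
    have hT' : conj (v N)⁻¹ (A N) (proj (block Y v N) f) = conj (v N)⁻¹ (A N) f :=
      congrArg (fun T : Opr Γ => T f) (conj_mul_proj_block hA N)
    have hsum : partialOp v A (N + 1) f = partialOp v A N f + conj (v N)⁻¹ (A N) f := by
      rw [partialOp_eq, partialOp_eq, Finset.sum_range_succ]
      rfl
    have hPP : ∀ (V W : Set Γ) (g : L2 Γ), proj V (proj W g) = proj (V ∩ W) g := fun V W g =>
      congrArg (fun T : Opr Γ => T g) (proj_mul_proj V W)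
    obtain ⟨h₁, h₂⟩ := ih
    rw [hU', hsum]
    constructor
    · rw [map_add]
      congr 1
      · rw [← h₁, hPP, Set.union_inter_cancel_left]
      · rw [← hT, hPP, Set.union_inter_cancel_right]
    · rw [norm_sq_proj_union hd, sq ‖_ + _‖, norm_add_sq_eq_norm_sq_add_norm_sq_of_inner_eq_zero
        (𝕜 := ℂ) _ _ (by rw [← h₁, ← hT]; exact inner_eq_zero_of_disjoint hd _ _), mul_add,
        ← sq, ← sq]
      refine add_le_add h₂ ?_
      rw [← hT', ← mul_pow]
      gcongr
      exact (conj (v N)⁻¹ (A N)).le_of_opNorm_le ((norm_conj_le _ _).trans (norm_apply_le _ _)) _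

theorem strongTendsto_Op (hA : A ∈ sectionAlgebra Y 𝒜)
    (hdisj : Pairwise fun m n => Disjoint (block Y v m) (block Y v n)) :
    StrongTendsto (partialOp v A) (Op v A) := by
  have h : ∃ T, StrongTendsto (partialOp v A) T := by
    refine exists_strongTendsto (norm_partialOp_le hA hdisj) fun t => ?_
    by_cases ht : ∃ n, t ∈ block Y v n
    · obtain ⟨n, hn⟩ := ht
      exact ⟨_, tendsto_partialOp_delta hA fun j hj => Set.disjoint_right.1 (hdisj hj) hn⟩
    -- Off all blocks every summand kills the basis vector, so any index serves.
    · exact ⟨_, tendsto_partialOp_delta hA (n := 0) fun j _ hj => ht ⟨j, hj⟩⟩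
  rw [Op, dif_pos h]
  exact h.choose_spec

/-- Reduces the adjoint half of every limit operator statement to the first half for `star A`. -/
theorem star_Op (hA : A ∈ sectionAlgebra Y 𝒜)
    (hdisj : Pairwise fun m n => Disjoint (block Y v m) (block Y v n)) :
    star (Op v A) = Op v (star A : BddSeq Γ) :=
  (eq_star_of_tendsto (strongTendsto_Op hA hdisj) fun x =>
    (strongTendsto_Op (star_mem_sectionAlgebra hA) hdisj x).congr fun N => by
      rw [star_partialOp]).symm

theorem Op_delta (hA : A ∈ sectionAlgebra Y 𝒜)
    (hdisj : Pairwise fun m n => Disjoint (block Y v m) (block Y v n)) {n : ℕ} {u : Γ}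
    (hu : ∀ j, j ≠ n → u ∉ block Y v j) : Op v A (delta u) = conj (v n)⁻¹ (A n) (delta u) :=
  tendsto_nhds_unique (strongTendsto_Op hA hdisj (delta u)) (tendsto_partialOp_delta hA hu)

theorem Op_delta_of_mem_complSet (hA : A ∈ sectionAlgebra Y 𝒜)
    (hdisj : Pairwise fun m n => Disjoint (block Y v m) (block Y v n)) {u : Γ}
    (hu : u ∈ complSet Y v) : Op v A (delta u) = 0 := by
  rw [Op_delta hA hdisj (n := 0) fun j _ => mem_complSet.1 hu j]
  exact conj_delta_of_notMem_block hA (mem_complSet.1 hu 0)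

variable {ι : Type*} {F : Filter ι} {h : ι → Γ} {κ : ι → ℕ}

/-- If all blocks except the `κ_m`-th leave every point after shifting by `h_m`, then only the
`κ_m`-th summand of `Op(A)` contributes to the shifted operator. -/
theorem tendsto_conj_Op_sub (hA : A ∈ sectionAlgebra Y 𝒜)
    (hdisj : Pairwise fun m n => Disjoint (block Y v m) (block Y v n))
    (hκ : ∀ t, ∀ᶠ m in F, ∀ j, j ≠ κ m → t * (h m)⁻¹ ∉ block Y v j) (x : L2 Γ) :
    Tendsto (fun m => conj (h m) (Op v A) x - conj ((v (κ m))⁻¹ * h m) (A (κ m)) x) F (𝓝 0) := by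
  refine tendsto_of_tendsto_delta (C := 0) (M := ‖Op v A‖ + ‖A‖)
    (B := fun m => conj (h m) (Op v A) - conj ((v (κ m))⁻¹ * h m) (A (κ m))) (fun m => ?_)
    (fun t => ?_) x
  · exact (norm_sub_le _ _).trans (add_le_add (norm_conj_le _ _)
      ((norm_conj_le _ _).trans (norm_apply_le _ _)))
  · refine tendsto_const_nhds.congr' ?_
    filter_upwards [hκ t] with m hm
    rw [← conj_conj, ← conj_sub, conj_delta]
    change 0 = R (h m)⁻¹ (Op v A (delta (t * (h m)⁻¹)) -
      conj (v (κ m))⁻¹ (A (κ m)) (delta (t * (h m)⁻¹)))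
    rw [Op_delta hA hdisj hm, sub_self, map_zero]

/-- The filter along which the sets `Y_k s` exhaust the group. -/
def exhaustion (Y : ℕ → Finset Γ) : Filter (ℕ × Γ) := ⨅ t : Γ, 𝓟 {p | t * p.2⁻¹ ∈ Y p.1}

theorem tendsto_exhaustion {f : ι → ℕ × Γ} :
    Tendsto f F (exhaustion Y) ↔ ∀ t, ∀ᶠ m in F, t * (f m).2⁻¹ ∈ Y (f m).1 := by
  simp only [exhaustion, tendsto_iInf, tendsto_principal]
  rfl

/-- A single limit serves all ways of moving deep into the blocks, so the strong limit of `A_n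
P_{Y_n}` and the limit operators of that kind agree. -/
theorem exists_isStarLimit_exhaustion (hA : A ∈ sectionAlgebra Y (Sh Γ : Set (Opr Γ))) :
    ∃ L, IsStarLimit (exhaustion Y) A L :=
  exists_isStarLimit (fun t => Or.inl (tendsto_exhaustion.1 tendsto_id t)) hA

theorem conj_proj_complSet_delta_of_mem {s t : Γ} {n : ℕ} (h : t * s⁻¹ ∈ block Y v n) :
    conj s (proj (complSet Y v)) (delta t) = 0 := by
  rw [conj_proj]
  exact proj_delta_of_notMem fun h' => mem_complSet.1 h' n h

theorem tendsto_conj_of_exhaustion (hA : A ∈ sectionAlgebra Y 𝒜)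
    (hdisj : Pairwise fun m n => Disjoint (block Y v m) (block Y v n))
    (hκ : ∀ t, ∀ᶠ m in F, t * (h m)⁻¹ ∈ block Y v (κ m)) {L : Opr Γ}
    (hL : ∀ x, Tendsto (fun p : ℕ × Γ => conj p.2 (A p.1) x) (exhaustion Y) (𝓝 (L x)))
    (x : L2 Γ) :
    Tendsto (fun m => conj (h m) (Op v A + proj (complSet Y v)) x) F (𝓝 (L x)) := by
  have h₁ : Tendsto (fun m => (κ m, (v (κ m))⁻¹ * h m)) F (exhaustion Y) := by
    refine tendsto_exhaustion.2 fun t => (hκ t).mono fun m hm => ?_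
    rw [mul_inv_rev, inv_inv, ← mul_assoc]
    exact hm
  have h₂ := tendsto_conj_Op_sub hA hdisj
    (fun t => (hκ t).mono fun m hm j hj => Set.disjoint_right.1 (hdisj hj) hm) x
  have h₃ : Tendsto (fun m => conj (h m) (proj (complSet Y v)) x) F (𝓝 ((0 : Opr Γ) x)) := by
    refine tendsto_of_tendsto_delta (M := 1) (fun m => (norm_conj_le _ _).trans (norm_proj_le _))
      (fun t => ?_) x
    refine tendsto_const_nhds.congr' ?_
    filter_upwards [hκ t] with m hm
    exact (conj_proj_complSet_delta_of_mem hm).symm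
  have h₄ := (h₂.add ((hL x).comp h₁)).add h₃
  rw [zero_add] at h₄
  simp only [zero_apply, add_zero] at h₄
  refine h₄.congr fun m => ?_
  rw [conj_add]
  simp

theorem conj_delta_of_forall_notMem (hA : A ∈ sectionAlgebra Y 𝒜)
    (hdisj : Pairwise fun m n => Disjoint (block Y v m) (block Y v n)) {s t : Γ}
    (h : ∀ n, t * s⁻¹ ∉ block Y v n) :
    conj s (Op v A + proj (complSet Y v)) (delta t) = delta t := by
  have h' := mem_complSet.2 h
  rw [conj_delta]
  change R s⁻¹ (Op v A (delta (t * s⁻¹)) + proj (complSet Y v) (delta (t * s⁻¹))) = _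
  rw [Op_delta_of_mem_complSet hA hdisj h', proj_delta_of_mem h', zero_add, R_delta]
  simp

theorem star_Op_add (hA : A ∈ sectionAlgebra Y 𝒜)
    (hdisj : Pairwise fun m n => Disjoint (block Y v m) (block Y v n)) :
    ContinuousLinearMap.adjoint (Op v A + proj (complSet Y v)) =
      Op v (star A : BddSeq Γ) + proj (complSet Y v) := by
  rw [map_add, adjoint_proj]
  congr 1
  exact star_Op hA hdisj

end Op

end

end GroupSections

namespace GroupSections

/-! ### Word balls and boundary crossings. -/

section Words

variable {Γ : Type*} [Group Γ] {Ω : Finset Γ}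

theorem words_mono {m n : ℕ} (h : m ≤ n) : words Ω m ⊆ words Ω n := by
  rintro _ ⟨l, hl, hlΩ, rfl⟩
  exact ⟨l, hl.trans h, hlΩ, rfl⟩

theorem one_mem_words (n : ℕ) : (1 : Γ) ∈ words Ω n :=
  ⟨[], Nat.zero_le _, by simp, rfl⟩

theorem mem_words_one {a : Γ} (ha : a ∈ Ω) : a ∈ words Ω 1 :=
  ⟨[a], le_rfl, by simpa using ha, by simp⟩

theorem mul_mem_words {m n : ℕ} {a b : Γ} (ha : a ∈ words Ω m) (hb : b ∈ words Ω n) :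
    a * b ∈ words Ω (m + n) := by
  obtain ⟨l, hl, hlΩ, rfl⟩ := ha
  obtain ⟨l', hl', hlΩ', rfl⟩ := hb
  refine ⟨l ++ l', ?_, ?_, List.prod_append⟩
  · rw [List.length_append]
    exact add_le_add hl hl'
  · intro a ha
    exact (List.mem_append.1 ha).elim (hlΩ a) (hlΩ' a)

theorem finite_words (Ω : Finset Γ) (n : ℕ) : (words Ω n).Finite := by
  induction n with
  | zero =>
    refine (Set.finite_singleton (1 : Γ)).subset ?_
    rintro _ ⟨l, hl, -, rfl⟩
    rw [List.length_eq_zero_iff.1 (Nat.le_zero.1 hl)]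
    exact List.prod_nil
  | succ n ih =>
    refine ((Set.finite_singleton (1 : Γ)).union (Ω.finite_toSet.mul ih)).subset ?_
    rintro _ ⟨_ | ⟨a, l⟩, hl, hlΩ, rfl⟩
    · exact Or.inl rfl
    · rw [List.prod_cons]
      exact Or.inr (Set.mul_mem_mul (hlΩ a (by simp))
        ⟨l, by simpa using hl, fun b hb => hlΩ b (by simp [hb]), rfl⟩)

theorem exists_mem_words (h_gen : ⋃ n, words Ω n = Set.univ) (g : Γ) : ∃ n, g ∈ words Ω n :=
  Set.mem_iUnion.1 (h_gen ▸ Set.mem_univ g)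

theorem eventually_mem_words (h_gen : ⋃ n, words Ω n = Set.univ) (g : Γ) :
    ∀ᶠ n in atTop, g ∈ words Ω n := by
  obtain ⟨n, hn⟩ := exists_mem_words h_gen g
  filter_upwards [eventually_ge_atTop n] with m hm
  exact words_mono hm hn

theorem exists_subset_words (h_gen : ⋃ n, words Ω n = Set.univ) {S : Set Γ} (hS : S.Finite) :
    ∃ n, S ⊆ words Ω n :=
  ((eventually_all_finite hS).2 fun g _ => eventually_mem_words h_gen g).exists

theorem countable_of_words (h_gen : ⋃ n, words Ω n = Set.univ) : Countable Γ := by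
  rw [← Set.countable_univ_iff, ← h_gen]
  exact Set.countable_iUnion fun n => (finite_words Ω n).countable

/-- A path of left multiplications by letters of `Ω` that leaves `S` meets the boundary of `S`. -/
theorem exists_mem_boundaryΩ {S : Set Γ} {x : Γ} (hx : x ∈ S) {n : ℕ} {a : Γ}
    (ha : a ∈ words Ω n) (hax : a * x ∉ S) : ∃ b ∈ words Ω n, b * x ∈ boundaryΩ Ω S := by
  obtain ⟨l, hl, hlΩ, rfl⟩ := ha
  induction l with
  | nil =>
    rw [List.prod_nil, one_mul] at hax
    exact (hax hx).elim
  | cons c l ih =>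
    have hl' : l.length ≤ n := (Nat.le_succ _).trans hl
    have hlΩ' : ∀ b ∈ l, b ∈ Ω := fun b hb => hlΩ b (by simp [hb])
    by_cases h : l.prod * x ∈ S
    · refine ⟨l.prod, ⟨l, hl', hlΩ', rfl⟩, h, fun hi => hax ?_⟩
      rw [List.prod_cons, mul_assoc]
      exact hi.2 c (hlΩ c (by simp))
    · exact ih hl' hlΩ' h

end Words

/-! ### Geometry of the blocks. -/

section Inflating

variable {Γ : Type*} [Group Γ] {Ω : Finset Γ} {Y : ℕ → Finset Γ} {v : ℕ → Γ}

theorem mul_inv_mul_mem_enlarge {n : ℕ} {a b c : Γ} (ha : a ∈ (Y n : Set Γ) ∪ words Ω n)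
    (hb : b ∈ (Y n : Set Γ) ∪ words Ω n) (hc : c ∈ (Y n : Set Γ) ∪ words Ω n) :
    a * b⁻¹ * c ∈ enlarge Ω Y n :=
  Set.mul_mem_mul (Set.mul_mem_mul ha (Set.inv_mem_inv.2 hb)) hc

theorem IsInflating.eq_of_mem (hv : IsInflating (enlarge Ω Y) v) {m n : ℕ} {a : Γ}
    (hm : a * v m ∈ enlarge Ω Y m) (hn : a * v n ∈ enlarge Ω Y n) : m = n := by
  by_contra h
  have h' := hv m n h
  rw [mul_singleton_inv_eq, mul_singleton_inv_eq] at h'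
  exact Set.disjoint_left.1 h' hm hn

theorem mem_enlarge_of_mem {n : ℕ} {y : Γ} (hy : y ∈ Y n) : y ∈ enlarge Ω Y n := by
  have h := mul_inv_mul_mem_enlarge (Ω := Ω) (Y := Y) (n := n) (Or.inl hy) (Or.inl hy) (Or.inl hy)
  simpa using h

theorem IsInflating.disjoint_block (hv : IsInflating (enlarge Ω Y) v) :
    Pairwise fun m n => Disjoint (block Y v m) (block Y v n) := fun _ _ hmn =>
  Set.disjoint_left.2 fun _ hm hn => hmn (hv.eq_of_mem (mem_enlarge_of_mem hm)
    (mem_enlarge_of_mem hn))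

/-- The product has the form `r 1⁻¹ y`, which lies in the enlarged set. The admissible word length
is the number of the starting block, so distances between blocks grow with that number. -/
theorem IsInflating.eq_of_mul_mem_block (hv : IsInflating (enlarge Ω Y) v) {n j : ℕ} {r z : Γ}
    (hr : r ∈ words Ω n) (hz : z ∈ block Y v n) (hj : r * z ∈ block Y v j) : j = n := by
  refine hv.eq_of_mem (mem_enlarge_of_mem hj) ?_
  have h := mul_inv_mul_mem_enlarge (Y := Y) (Or.inr hr) (Or.inr (one_mem_words n)) (Or.inl hz)
  rwa [inv_one, mul_one, ← mul_assoc] at h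

theorem IsInflating.injective (hv : IsInflating (enlarge Ω Y) v) : Function.Injective v := by
  have h : ∀ n, (1 : Γ) ∈ enlarge Ω Y n := fun n => by
    have h := mul_inv_mul_mem_enlarge (Y := Y) (Or.inr (one_mem_words (Ω := Ω) n))
      (Or.inr (one_mem_words n)) (Or.inr (one_mem_words n))
    simpa using h
  intro m n hmn
  refine hv.eq_of_mem (a := (v m)⁻¹) ?_ ?_
  · rw [inv_mul_cancel]
    exact h m
  · rw [hmn, inv_mul_cancel]
    exact h n

theorem IsInflating.tendsto_cofinite (hv : IsInflating (enlarge Ω Y) v) :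
    Tendsto v atTop cofinite := by
  rw [← Nat.cofinite_eq_atTop]
  exact hv.injective.tendsto_cofinite

/-- If a block contains the point `w` after shifting by `h_m` and its number tends to infinity, then
all other blocks leave every point. -/
theorem IsInflating.eventually_notMem_block (hv : IsInflating (enlarge Ω Y) v)
    (h_gen : ⋃ n, words Ω n = Set.univ) {ι : Type*} {F : Filter ι} {h : ι → Γ} {κ : ι → ℕ}
    (hκ : Tendsto κ F atTop) {w : Γ} (hw : ∀ m, w * (h m)⁻¹ ∈ block Y v (κ m)) (t : Γ) :
    ∀ᶠ m in F, ∀ j, j ≠ κ m → t * (h m)⁻¹ ∉ block Y v j := by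
  filter_upwards [hκ.eventually (eventually_mem_words h_gen (t * w⁻¹))] with m hm j hj hmem
  refine hj (hv.eq_of_mul_mem_block hm (hw m) ?_)
  rwa [← mul_assoc, inv_mul_cancel_right]

/-- Outside every finite set there are points that are far away from all blocks. -/
theorem IsInflating.exists_far_from_blocks (hv : IsInflating (enlarge Ω Y) v)
    (h_gen : ⋃ n, words Ω n = Set.univ) (hY : ∀ x : Γ, ∀ᶠ n in atTop, x ∈ Y n) (m : ℕ)
    {K : Set Γ} (hK : K.Finite) : ∃ x ∉ K, ∀ r ∈ words Ω m, ∀ j, r * x ∉ block Y v j := by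
  by_contra! hcon
  -- `D j` is a neighbourhood of the `j`-th block; under `hcon` these neighbourhoods cover
  -- everything outside `K`.
  set D : ℕ → Set Γ := fun j => {x | ∃ r ∈ words Ω m, r * x ∈ block Y v j} with hD
  have hDfin : ∀ j, (D j).Finite := by
    intro j
    refine ((finite_words Ω m).inv.mul (finite_block (Y := Y) (v := v) j)).subset ?_
    rintro x ⟨r, hr, hx⟩
    exact ⟨r⁻¹, Set.inv_mem_inv.2 hr, r * x, hx, inv_mul_cancel_left r x⟩
  -- For `j > m` a point of `D j`, even after one more letter `c`, has the form `c r⁻¹ y` with `c, r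
  -- ∈ Ω_j` and `y ∈ Y_j`, and so stays in the enlarged set.
  have hDE : ∀ j, m + 1 ≤ j → ∀ x ∈ D j, ∀ c ∈ words Ω 1, c * x * v j ∈ enlarge Ω Y j := by
    rintro j hj x ⟨r, hr, hx⟩ c hc
    have h := mul_inv_mul_mem_enlarge (Y := Y) (Or.inr (words_mono (by omega) hc))
      (Or.inr (words_mono (by omega : m ≤ j) hr)) (Or.inl hx)
    have h' : c * r⁻¹ * (r * x * v j) = c * x * v j := by group
    rwa [h'] at h
  set K' : Set Γ := K ∪ ⋃ j ∈ Set.Iio (m + 1), D j with hK'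
  have hK'fin : K'.Finite := hK.union ((Set.finite_Iio _).biUnion fun j _ => hDfin j)
  -- Each point lies in at most one shifted enlarged set, so only finitely many of these meet the
  -- finite set `K'`.
  have hfin : (⋃ x ∈ K', {j | x * v j ∈ enlarge Ω Y j}).Finite :=
    hK'fin.biUnion fun x _ => Set.Subsingleton.finite fun i hi j hj => hv.eq_of_mem hi hj
  obtain ⟨j, ⟨hj₁, hj₂⟩, hj₃⟩ := (((eventually_ge_atTop (m + 1)).and (hY 1)).and
    (Nat.cofinite_eq_atTop ▸ hfin.eventually_cofinite_notMem)).exists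
  -- The new point avoids `K'`, so it lies in some `D i` with `i > m`; then it is in the enlarged
  -- sets of both `i` and `j`, which forces `i = j`.
  have hmem : ∀ x ∈ D j, ∀ c ∈ Ω, c * x ∈ D j := by
    intro x hx c hc
    have hE := hDE j hj₁ x hx c (mem_words_one hc)
    have hnot : c * x ∉ K' := fun h => hj₃ (Set.mem_biUnion h hE)
    obtain ⟨r, hr, i, hi⟩ := hcon (c * x) fun h => hnot (Or.inl h)
    have hDi : c * x ∈ D i := ⟨r, hr, hi⟩
    have hmi : m + 1 ≤ i := by
      by_contra! hlt
      exact hnot (Or.inr (Set.mem_biUnion (Set.mem_Iio.2 hlt) hDi))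
    have h := hDE i hmi _ hDi 1 (one_mem_words 1)
    rw [one_mul] at h
    rwa [hv.eq_of_mem hE h]
  have hbase : (v j)⁻¹ ∈ D j := ⟨1, one_mem_words m, by simpa [block] using hj₂⟩
  have hlist : ∀ l : List Γ, (∀ a ∈ l, a ∈ Ω) → l.prod * (v j)⁻¹ ∈ D j := by
    intro l
    induction l with
    | nil => simpa using hbase
    | cons a l ih =>
      intro hl
      rw [List.prod_cons, mul_assoc]
      exact hmem _ (ih fun b hb => hl b (by simp [hb])) a (hl a (by simp))
  -- The letters generate `Γ` as a semigroup, so the finite set `D j` would be all of `Γ`.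
  have : Infinite Γ := Infinite.of_injective v hv.injective
  refine Set.infinite_univ ((hDfin j).subset fun x _ => ?_)
  obtain ⟨n, l, -, hl, hprod⟩ := exists_mem_words h_gen (x * v j)
  have h := hlist l hl
  rwa [hprod, mul_inv_cancel_right] at h

theorem IsInflating.exists_seq_far_from_blocks (hv : IsInflating (enlarge Ω Y) v)
    (h_gen : ⋃ n, words Ω n = Set.univ) (hY : ∀ x : Γ, ∀ᶠ n in atTop, x ∈ Y n) :
    ∃ h : ℕ → Γ, Tendsto h atTop cofinite ∧
      ∀ t, ∀ᶠ m in atTop, ∀ n, t * (h m)⁻¹ ∉ block Y v n := by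
  choose x hx hfar using fun m => hv.exists_far_from_blocks h_gen hY m (finite_words Ω m)
  refine ⟨fun m => (x m)⁻¹, le_cofinite_iff_eventually_ne.2 fun g => eventually_map.2 ?_, fun t => ?_⟩
  · filter_upwards [eventually_mem_words h_gen g⁻¹] with m hm hg
    rw [← hg, inv_inv] at hm
    exact hx m hm
  · filter_upwards [eventually_mem_words h_gen t] with m hm n
    rw [inv_inv]
    exact hfar m t hm n

end Inflating

end GroupSections

namespace GroupSections

/-! ### Classification of the limit operators. -/

section LimitOperators

variable {Γ : Type*} [Group Γ] {Ω : Finset Γ} {Y : ℕ → Finset Γ} {v : ℕ → Γ} {𝒜 : Set (Opr Γ)}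
  {A : BddSeq Γ}

theorem isLimitOperator_iff {T : Opr Γ} {h : ℕ → Γ} {B : Opr Γ} :
    IsLimitOperator T h B ↔ Tendsto h atTop cofinite ∧
      (∀ x, Tendsto (fun m => conj (h m) T x) atTop (𝓝 (B x))) ∧
      ∀ x, Tendsto (fun m => conj (h m) (ContinuousLinearMap.adjoint T) x) atTop
        (𝓝 (ContinuousLinearMap.adjoint B x)) :=
  Iff.rfl

/-- Since the limit is known to exist, it is determined by infinitely many indices at each basis
vector. -/
theorem eq_one_of_frequently_far (hA : A ∈ sectionAlgebra Y 𝒜) (hv : IsInflating (enlarge Ω Y) v)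
    (h_gen : ⋃ n, words Ω n = Set.univ) {h : ℕ → Γ} {B : Opr Γ}
    (hB : IsLimitOperator (Op v A + proj (complSet Y v)) h B)
    (hfar : ∀ r, ∃ᶠ m in atTop, ∀ t ∈ words Ω r, ∀ n, t * (h m)⁻¹ ∉ block Y v n) : B = 1 := by
  refine ext_delta fun t => ?_
  obtain ⟨r, hr⟩ := exists_mem_words h_gen t
  exact tendsto_nhds_unique_of_frequently_eq ((isLimitOperator_iff.1 hB).2.1 (delta t))
    tendsto_const_nhds ((hfar r).mono fun m hm =>
      conj_delta_of_forall_notMem hA hv.disjoint_block (hm t hr))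

theorem eq_of_frequently_subset_block (hA : A ∈ sectionAlgebra Y 𝒜)
    (hv : IsInflating (enlarge Ω Y) v) (h_gen : ⋃ n, words Ω n = Set.univ) {h : ℕ → Γ}
    {B L : Opr Γ} (hB : IsLimitOperator (Op v A + proj (complSet Y v)) h B)
    (hL : IsStarLimit (exhaustion Y) A L)
    (hsub : ∀ r, ∃ᶠ m in atTop, ∃ n, ∀ t ∈ words Ω r, t * (h m)⁻¹ ∈ block Y v n) : B = L := by
  obtain ⟨φ, hφ, hφ'⟩ := extraction_forall_of_frequently hsub
  choose κ hκ using hφ'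
  refine ContinuousLinearMap.ext fun x => ?_
  refine tendsto_nhds_unique
    (((isLimitOperator_iff.1 hB).2.1 x).comp hφ.tendsto_atTop)
    (tendsto_conj_of_exhaustion (h := h ∘ φ) (κ := κ) hA hv.disjoint_block (fun t => ?_)
      (fun x => (hL x).1) x)
  filter_upwards [eventually_mem_words h_gen t] with r hr
  exact hκ r t hr

/-- Shifts which neither miss all blocks nor move into the interior of the blocks see a boundary
point of a block at a bounded distance. -/
theorem exists_frequently_mem_boundaryΩ (h_gen : ⋃ n, words Ω n = Set.univ) {h : ℕ → Γ} {r s : ℕ}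
    (hr : ∀ᶠ m in atTop, ∃ t ∈ words Ω r, ∃ n, t * (h m)⁻¹ ∈ block Y v n)
    (hs : ∀ᶠ m in atTop, ∀ n, ∃ t ∈ words Ω s, t * (h m)⁻¹ ∉ block Y v n) :
    ∃ w, ∃ᶠ m in atTop, ∃ n, w * (h m)⁻¹ * v n ∈ boundaryΩ Ω (Y n : Set Γ) := by
  -- The word `u t⁻¹` leads from the point inside the block to the point outside; its length is
  -- bounded independently of `m`.
  obtain ⟨N, hN⟩ := exists_subset_words h_gen ((finite_words Ω s).mul (finite_words Ω r).inv)
  have hev : ∀ᶠ m in atTop, ∃ w ∈ words Ω (N + r), ∃ n,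
      w * (h m)⁻¹ * v n ∈ boundaryΩ Ω (Y n : Set Γ) := by
    filter_upwards [hr, hs] with m hm₁ hm₂
    obtain ⟨t, ht, n, hn⟩ := hm₁
    obtain ⟨u, hu, hun⟩ := hm₂ n
    obtain ⟨b, hb, hb'⟩ := exists_mem_boundaryΩ (Ω := Ω) (S := (Y n : Set Γ)) hn
      (hN (Set.mul_mem_mul hu (Set.inv_mem_inv.2 ht))) (by
        rwa [mul_assoc t, ← mul_assoc, inv_mul_cancel_right, ← mul_assoc])
    exact ⟨b * t, mul_mem_words hb ht, n, by simpa only [mul_assoc] using hb'⟩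
  -- Pigeonhole over the finite ball of possible `w`.
  by_contra! hcon
  have hall := (eventually_all_finite (finite_words Ω (N + r))).2 fun w _ =>
    hcon w
  obtain ⟨m, ⟨w, hw, hwn⟩, hm⟩ := (hev.and hall).exists
  obtain ⟨n, hn⟩ := hwn
  exact hm w hw n hn

theorem eventually_notMem_block_of_lt {h : ℕ → Γ} (hh : Tendsto h atTop cofinite) (w : Γ) (K : ℕ) :
    ∀ᶠ m in atTop, ∀ n < K, w * (h m)⁻¹ ∉ block Y v n := by
  have hfin : (⋃ n ∈ Set.Iio K, {g : Γ | w * g⁻¹ ∈ block Y v n}).Finite := by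
    refine (Set.finite_Iio K).biUnion fun n _ => (finite_block n).preimage fun a _ b _ hab => ?_
    exact inv_injective (mul_left_cancel hab)
  filter_upwards [hh.eventually hfin.eventually_cofinite_notMem] with m hm n hn hmem
  exact hm (Set.mem_biUnion (Set.mem_Iio.2 hn) hmem)

theorem exists_strictMono_mem_boundaryΩ {h : ℕ → Γ} (hh : Tendsto h atTop cofinite) {w : Γ}
    (hw : ∃ᶠ m in atTop, ∃ n, w * (h m)⁻¹ * v n ∈ boundaryΩ Ω (Y n : Set Γ)) :
    ∃ φ k : ℕ → ℕ, StrictMono φ ∧ StrictMono k ∧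
      ∀ j, w * (h (φ j))⁻¹ * v (k j) ∈ boundaryΩ Ω (Y (k j) : Set Γ) := by
  have hfreq : ∀ K, ∃ᶠ m in atTop, ∃ n, K ≤ n ∧
      w * (h m)⁻¹ * v n ∈ boundaryΩ Ω (Y n : Set Γ) := fun K => by
    refine (hw.and_eventually (eventually_notMem_block_of_lt (Y := Y) (v := v) hh w K)).mono ?_
    rintro m ⟨⟨n, hn⟩, hm⟩
    exact ⟨n, not_lt.1 fun hlt => hm n hlt hn.1, hn⟩
  obtain ⟨φ, hφ, hφ'⟩ := extraction_forall_of_frequently hfreq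
  choose k hk hk' using hφ'
  obtain ⟨ψ, hψ, hψ'⟩ := strictMono_subseq_of_tendsto_atTop
    (tendsto_atTop_mono hk tendsto_id)
  exact ⟨φ ∘ ψ, k ∘ ψ, hφ.comp hψ, hψ', fun j => hk' (ψ j)⟩

/-- Every sequence tending to infinity has a subsequence along which the limit operator of a
coordinate projection exists. -/
theorem exists_isLimitOperator_proj [Countable Γ] (Z : Set Γ) {h : ℕ → Γ}
    (hh : Tendsto h atTop cofinite) :
    ∃ φ : ℕ → ℕ, StrictMono φ ∧ ∃ Q, IsLimitOperator (proj Z) (h ∘ φ) Q := by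
  classical
  -- `Γ` is countable, so `Γ → Bool` is sequentially compact; pointwise convergence of indicators is
  -- strong convergence of the projections.
  obtain ⟨a, φ, hφ, ha⟩ := CompactSpace.tendsto_subseq
    (fun m t => decide (t * (h m)⁻¹ ∈ Z) : ℕ → Γ → Bool)
  have hlim : ∀ x, Tendsto (fun m => conj (h (φ m)) (proj Z) x) atTop
      (𝓝 (proj {t | a t = true} x)) := by
    refine tendsto_of_tendsto_delta (M := 1) (fun m => (norm_conj_le _ _).trans (norm_proj_le _))
      fun t => tendsto_const_nhds.congr' ?_
    have ht := tendsto_pi_nhds.1 ha t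
    rw [nhds_discrete, tendsto_pure] at ht
    filter_upwards [ht] with m hm
    rw [conj_proj]
    change decide (t * (h (φ m))⁻¹ ∈ Z) = a t at hm
    by_cases hat : a t = true
    · rw [proj_delta_of_mem (show t ∈ {t | a t = true} from hat), proj_delta_of_mem]
      exact of_decide_eq_true (hm.trans hat)
    · rw [proj_delta_of_notMem (show t ∉ {t | a t = true} from hat), proj_delta_of_notMem]
      intro hmem
      exact hat (hm ▸ decide_eq_true hmem)
  refine ⟨φ, hφ, proj {t | a t = true}, isLimitOperator_iff.2
    ⟨hh.comp hφ.tendsto_atTop, hlim, ?_⟩⟩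
  rw [adjoint_proj, adjoint_proj]
  exact hlim

theorem conj_inv_mul_eq {w η : Γ} (T : Opr Γ) :
    R w⁻¹ * R η⁻¹ * T * R η * R w = conj (η * w) T := by
  simp only [conj, mul_inv_rev, map_mul, mul_assoc]

theorem exists_isBoundaryLimit (hA : A ∈ sectionAlgebra Y 𝒜) (hv : IsInflating (enlarge Ω Y) v)
    (h_gen : ⋃ n, words Ω n = Set.univ) {h : ℕ → Γ} {B : Opr Γ}
    (hB : IsLimitOperator (Op v A + proj (complSet Y v)) h B) {w : Γ}
    (hw : ∃ᶠ m in atTop, ∃ n, w * (h m)⁻¹ * v n ∈ boundaryΩ Ω (Y n : Set Γ)) :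
    ∃ φ : ℕ → ℕ, StrictMono φ ∧ IsBoundaryLimit Ω Y v A (h ∘ φ) B := by
  have := countable_of_words h_gen
  obtain ⟨hh, hB', -⟩ := isLimitOperator_iff.1 hB
  obtain ⟨φ, k, hφ, hk, hbd⟩ := exists_strictMono_mem_boundaryΩ hh hw
  obtain ⟨ψ, hψ, Q, hQ⟩ := exists_isLimitOperator_proj (complSet Y v)
    (hh.comp hφ.tendsto_atTop)
  have hφψ := hφ.comp hψ
  have hkψ := hk.comp hψ
  -- `η` is solved from `v η w = h`. Convergence of the block summand need not be shown separately:
  -- its limit is the difference of the two known limits `B` and `Q`.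
  refine ⟨φ ∘ ψ, hφψ, k ∘ ψ, fun n => (v (k (ψ n)))⁻¹ * h (φ (ψ n)) * w⁻¹, w, B - Q, Q, hkψ,
    fun n => ?_, fun n => ?_, fun x => ?_, hQ, (sub_add_cancel B Q).symm⟩
  · rw [Set.mem_inv]
    simpa [mul_assoc] using hbd (ψ n)
  · simp [mul_assoc]
  · simp only [conj_inv_mul_eq, inv_mul_cancel_right]
    have h₁ := tendsto_conj_Op_sub (h := h ∘ φ ∘ ψ) (κ := k ∘ ψ) hA hv.disjoint_block
      (hv.eventually_notMem_block h_gen hkψ.tendsto_atTop fun m => (hbd (ψ m)).1) x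
    have h₂ := ((hB' x).comp hφψ.tendsto_atTop).sub ((isLimitOperator_iff.1 hQ).2.1 x)
    have h₃ := h₂.sub h₁
    rw [sub_zero] at h₃
    refine h₃.congr fun m => ?_
    simp [conj_add]

theorem eq_or_exists_isBoundaryLimit (hA : A ∈ sectionAlgebra Y 𝒜)
    (hv : IsInflating (enlarge Ω Y) v) (h_gen : ⋃ n, words Ω n = Set.univ) {h : ℕ → Γ}
    {B L : Opr Γ} (hB : IsLimitOperator (Op v A + proj (complSet Y v)) h B)
    (hL : IsStarLimit (exhaustion Y) A L) :
    B = 1 ∨ B = L ∨ ∃ φ : ℕ → ℕ, StrictMono φ ∧ IsBoundaryLimit Ω Y v A (h ∘ φ) B := by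
  by_cases h₁ : ∀ r, ∃ᶠ m in atTop, ∀ t ∈ words Ω r, ∀ n, t * (h m)⁻¹ ∉ block Y v n
  · exact Or.inl (eq_one_of_frequently_far hA hv h_gen hB h₁)
  by_cases h₂ : ∀ r, ∃ᶠ m in atTop, ∃ n, ∀ t ∈ words Ω r, t * (h m)⁻¹ ∈ block Y v n
  · exact Or.inr (Or.inl (eq_of_frequently_subset_block hA hv h_gen hB hL h₂))
  push Not at h₁ h₂
  obtain ⟨r, hr⟩ := h₁
  obtain ⟨s, hs⟩ := h₂
  obtain ⟨w, hw⟩ := exists_frequently_mem_boundaryΩ h_gen hr hs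
  exact Or.inr (Or.inr (exists_isBoundaryLimit hA hv h_gen hB hw))

theorem exists_isLimitOperator_one (hA : A ∈ sectionAlgebra Y 𝒜)
    (hv : IsInflating (enlarge Ω Y) v) (h_gen : ⋃ n, words Ω n = Set.univ)
    (hY : ∀ x : Γ, ∀ᶠ n in atTop, x ∈ Y n) :
    ∃ h : ℕ → Γ, IsLimitOperator (Op v A + proj (complSet Y v)) h 1 := by
  obtain ⟨h, hh, hfar⟩ := hv.exists_seq_far_from_blocks h_gen hY
  have key : ∀ C ∈ sectionAlgebra Y 𝒜, ∀ x,
      Tendsto (fun m => conj (h m) (Op v C + proj (complSet Y v)) x) atTop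
        (𝓝 ((1 : Opr Γ) x)) := by
    intro C hC
    refine tendsto_of_tendsto_delta (fun m => norm_conj_le _ _) fun t => ?_
    refine tendsto_const_nhds.congr' ((hfar t).mono fun m hm => ?_)
    exact (conj_delta_of_forall_notMem hC hv.disjoint_block hm).symm
  refine ⟨h, isLimitOperator_iff.2 ⟨hh, key A hA, ?_⟩⟩
  have h₁ : ContinuousLinearMap.adjoint (1 : Opr Γ) = 1 := star_one (Opr Γ)
  rw [star_Op_add hA hv.disjoint_block, h₁]
  exact key _ (star_mem_sectionAlgebra hA)

/-- Shifting by `v_m` moves the `m`-th block back onto `Y_m`, and these sets exhaust `Γ`. -/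
theorem isLimitOperator_inflating (hA : A ∈ sectionAlgebra Y 𝒜)
    (hv : IsInflating (enlarge Ω Y) v) (hY : ∀ x : Γ, ∀ᶠ n in atTop, x ∈ Y n) {L : Opr Γ}
    (hL : IsStarLimit (exhaustion Y) A L) :
    IsLimitOperator (Op v A + proj (complSet Y v)) v L := by
  have hκ : ∀ t, ∀ᶠ m in atTop, t * (v m)⁻¹ ∈ block Y v m := fun t => by
    simpa [block] using hY t
  refine isLimitOperator_iff.2 ⟨hv.tendsto_cofinite,
    tendsto_conj_of_exhaustion hA hv.disjoint_block hκ fun x => (hL x).1, ?_⟩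
  rw [star_Op_add hA hv.disjoint_block]
  exact tendsto_conj_of_exhaustion (star_mem_sectionAlgebra hA) hv.disjoint_block hκ
    fun x => (hL x).2

/-- Strong convergence of the shifted sequence implies strong convergence of the adjoints. -/
theorem tendsto_conj_star {ι : Type*} {F : Filter ι}
    (hA : A ∈ sectionAlgebra Y (Sh Γ : Set (Opr Γ))) {p : ι → ℕ × Γ} {C : Opr Γ}
    (hC : ∀ x, Tendsto (fun i => conj (p i).2 (A (p i).1) x) F (𝓝 (C x))) (x : L2 Γ) :
    Tendsto (fun i => conj (p i).2 (star (A (p i).1)) x) F (𝓝 (star C x)) := by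
  -- An ultrafilter decides, for each `t`, whether `t` lies in the shifted set, so a *-strong limit
  -- exists along it; uniqueness of strong limits identifies it with `C`.
  rw [tendsto_iff_ultrafilter]
  intro U hU
  obtain ⟨L, hL⟩ := exists_isStarLimit (F := Filter.map p U)
    (fun t => U.em fun i => t * (p i).2⁻¹ ∈ Y (p i).1) hA
  have hCL : C = L := ContinuousLinearMap.ext fun y =>
    tendsto_nhds_unique ((hC y).mono_left hU) (tendsto_map'_iff.1 (hL y).1)
  rw [hCL]
  exact tendsto_map'_iff.1 (hL x).2

theorem isLimitOperator_of_isBoundaryLimit (hA : A ∈ sectionAlgebra Y (Sh Γ : Set (Opr Γ)))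
    (hv : IsInflating (enlarge Ω Y) v) (h_gen : ⋃ n, words Ω n = Set.univ) {g : ℕ → Γ} {B : Opr Γ}
    (hB : IsBoundaryLimit Ω Y v A g B) :
    IsLimitOperator (Op v A + proj (complSet Y v)) g B := by
  obtain ⟨k, η, w, C, Q, hk, hη, hg, hC, hQ, rfl⟩ := hB
  obtain ⟨hg', hQ₁, hQ₂⟩ := isLimitOperator_iff.1 hQ
  have hgη : ∀ n, (v (k n))⁻¹ * g n = η n * w := fun n => by
    rw [hg, mul_assoc, inv_mul_cancel_left]
  -- As `η_n⁻¹ ∈ Y_{k_n}`, the point `w` always lies in the shifted block `k_n`, which keeps that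
  -- block in view while the others leave.
  have hw : ∀ n, w * (g n)⁻¹ ∈ block Y v (k n) := fun n => by
    have h : w * (g n)⁻¹ * v (k n) = (η n)⁻¹ := by
      rw [hg]
      group
    have hY : w * (g n)⁻¹ * v (k n) ∈ (Y (k n) : Set Γ) := h ▸ (Set.mem_inv.1 (hη n)).1
    exact hY
  have hfar := hv.eventually_notMem_block h_gen hk.tendsto_atTop hw
  have hC' : ∀ x, Tendsto (fun n => conj (η n * w) (A (k n)) x) atTop (𝓝 (C x)) := fun x =>
    (hC x).congr fun n =>
    congrArg (fun T : Opr Γ => T x) (conj_inv_mul_eq (A (k n)))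
  refine isLimitOperator_iff.2 ⟨hg', fun x => ?_, fun x => ?_⟩
  · have h := ((tendsto_conj_Op_sub hA hv.disjoint_block hfar x).add (hC' x)).add (hQ₁ x)
    rw [zero_add] at h
    refine h.congr fun n => ?_
    simp [hgη, conj_add]
  · have h := ((tendsto_conj_Op_sub (star_mem_sectionAlgebra hA) hv.disjoint_block hfar x).add
      (tendsto_conj_star (p := fun n => (k n, η n * w)) hA hC' x)).add (hQ₂ x)
    rw [zero_add] at h
    rw [star_Op_add hA hv.disjoint_block, map_add]
    refine h.congr fun n => ?_
    simp [hgη, conj_add, adjoint_proj]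

theorem strongTendsto_of_isStarLimit_exhaustion (hA : A ∈ sectionAlgebra Y 𝒜)
    (hY : ∀ x : Γ, ∀ᶠ n in atTop, x ∈ Y n) {L : Opr Γ} (hL : IsStarLimit (exhaustion Y) A L) :
    StrongTendsto (fun n => A n * proj (Y n : Set Γ)) L := by
  intro x
  have h : Tendsto (fun n : ℕ => (n, (1 : Γ))) atTop (exhaustion Y) :=
    tendsto_exhaustion.2 fun t => by simpa using hY t
  refine ((hL x).1.comp h).congr fun n => ?_
  exact congrArg (fun T : Opr Γ => T x)
    ((conj_one_left (A n)).trans (proj_mul_apply_mul_proj hA n).2.symm)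

end LimitOperators

end GroupSections

theorem theorem4 {Γ : Type*} [Group Γ]
    (Ω : Finset Γ) (h_one : (1 : Γ) ∈ Ω) (h_gen : ⋃ n, words Ω n = Set.univ)
    (Y : ℕ → Finset Γ) (hY : ∀ x : Γ, ∀ᶠ n in atTop, x ∈ Y n)
    (v : ℕ → Γ) (hv : IsInflating (enlarge Ω Y) v)
    (A : BddSeq Γ) (hA : A ∈ sectionAlgebra Y (Sh Γ : Set (Opr Γ))) :
    StrongTendsto (partialOp v A) (Op v A) ∧
    ∃ A₀ : Opr Γ, StrongTendsto (fun n => A n * proj (Y n : Set Γ)) A₀ ∧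
      (∀ (h : ℕ → Γ) (B : Opr Γ),
        IsLimitOperator (Op v A + proj (complSet Y v)) h B →
          B = 1 ∨ B = A₀ ∨
            ∃ φ : ℕ → ℕ, StrictMono φ ∧ IsBoundaryLimit Ω Y v A (h ∘ φ) B) ∧
      {B : Opr Γ | ∃ h : ℕ → Γ, IsLimitOperator (Op v A + proj (complSet Y v)) h B} =
        {1, A₀} ∪ {B : Opr Γ | ∃ g : ℕ → Γ, IsBoundaryLimit Ω Y v A g B} := by
  obtain ⟨A₀, hA₀⟩ := exists_isStarLimit_exhaustion hA
  have hlim : ∀ (h : ℕ → Γ) (B : Opr Γ), IsLimitOperator (Op v A + proj (complSet Y v)) h B →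
      B = 1 ∨ B = A₀ ∨ ∃ φ : ℕ → ℕ, StrictMono φ ∧ IsBoundaryLimit Ω Y v A (h ∘ φ) B :=
    fun h B hB => eq_or_exists_isBoundaryLimit hA hv h_gen hB hA₀
  refine ⟨strongTendsto_Op hA hv.disjoint_block, A₀,
    strongTendsto_of_isStarLimit_exhaustion hA hY hA₀, hlim, Set.Subset.antisymm ?_ ?_⟩
  · rintro B ⟨h, hB⟩
    rcases hlim h B hB with h₁ | h₂ | ⟨φ, -, hφ⟩
    · exact Or.inl (Or.inl h₁)
    · exact Or.inl (Or.inr h₂)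
    · exact Or.inr ⟨_, hφ⟩
  · rintro B ((rfl | rfl) | ⟨g, hg⟩)
    · exact exists_isLimitOperator_one hA hv h_gen hY
    · exact ⟨v, isLimitOperator_inflating hA hv hY hA₀⟩
    · exact ⟨g, isLimitOperator_of_isBoundaryLimit hA hv h_gen hg⟩
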